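/- **Setting.** A seller reaches a consumer only through an intermediary. The intermediary's value is $\theta_1\sim G$, the consumer's value is $\theta_2\sim F$, independent, privately known. $F$ and $G$ are distributions on $[0,1]$ with full support, densities $f,g$ and increasing hazard rates $f/(1-F)$, $g/(1-G)$ on $[0,1)$. There are stochastic gains from trade: $F(v\mid v\ge p)\le G(v\mid v\ge p)$ for all $p\in[0,1]$, $v\ge p$. Put $\psi_H(x)=x-\frac{1-H(x)}{h(x)}$ for $(H,h)\in\{(F,f),(G,g)\}$ (with $\psi_H(x)=-\infty$ if $h(x)=0<1-H(x)$, and $\psi_H(1)=1$), a strictly increasing function, and let $\psi_H^{-1}(y)=\inf\{x\in[0,1]:\psi_H(x)\ge y\}$ be its inverse. **Delegation.** An outcome is $(q_1,q_2,t_1,t_2)$, where $q_1,q_2\ge0$, $q_1+q_2\le1$ are the probabilities that the intermediary, respectively the consumer, gets the good and $t_1,t_2\in\mathbb R$ are their payments to the seller. Utilities are $\theta_iq_i-t_i$; the default outcome is $o=(0,0,0,0)$. The seller fixes a family $\mathcal C=\{C^\lambda\}_{\lambda\in\Lambda}$ of menus (sets of outcomes). The intermediary, knowing $\theta_1$, offers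 a menu or opts out (yielding $o$); the consumer, knowing $\theta_2$, picks an outcome from the offered menu or $o$. Mixed strategies are allowed, and the solution concept is perfect Bayesian equilibrium. Only equilibria with well-defined expected payoffs and finite expected transfers are considered; the seller's revenue is the expectation of $t_1+t_2$. Buybacks are *absent* in an equilibrium if the (expected) total allocation $q_1+q_2$ conditional on $(\theta_1,\theta_2)$ is a function $\gamma(\theta_1)$ of the intermediary's type only. Let $\pi^{BB}$ be the supremum of the revenues over all families of menus and all their equilibria, and $\pi^N$ the supremum over those without buybacks. A *price agreement* with resale price $p$ and discounted price $w$ is the menu of two outcomes: the consumer buys the good, $(q_1,q_2,t_1,t_2)=(0,1,w-p,p)$; or he does not and the intermediary keeps it, $(1,0,w,0)$. **Proposition.** Let $\hat p=\psi_F^{-1}(\psi_G(0))$, which lies in $[0,1]$, and for $p\in[\hat p,1]$ let $$d(p)=pF(p)-\int_{\hat p}^{p}\psi_G^{-1}\bigl(\psi_F(x)\bigr)f(x)\,dx .$$ Then $d(p)\in[0,p]$ for all $p\in[\hat p,1]$. Let $C^p$ be the price agreement with resale price $p$ and discounted price $p-d(p)$. The family $\{C^p\}_{p\in[\hat p,1]}$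 has an equilibrium without buybacks in which no type of the intermediary opts out and the good always ends up with the intermediary or the consumer, and whose revenue is maximal among all equilibria without buybacks of all families of menus; so its revenue is $\pi^N$. Moreover $\pi^{BB}$ is finite and $$\tfrac12\,\pi^{BB}\le\pi^N\le\pi^{BB}.$$ -/

import Mathlib

open MeasureTheory ProbabilityTheory Set
open scoped ENNReal

noncomputable section

namespace Resale

/-! ### Type distributions and virtual values -/

/-- `H` is a probability distribution on `[0,1]` with full support and density `h`, whose hazard
rate `h / (1 - H)` is increasing on `[0,1)`. -/
structure IsTypeLaw (H : Measure ℝ) (h : ℝ → ℝ) : Prop where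
  isProb : IsProbabilityMeasure H
  measurable_density : Measurable h
  density_nonneg : ∀ x ∈ Icc (0 : ℝ) 1, 0 ≤ h x
  eq_withDensity :
    H = (volume.restrict (Icc (0 : ℝ) 1)).withDensity (fun x => ENNReal.ofReal (h x))
  full_support : H.support = Icc (0 : ℝ) 1
  hazard_mono : MonotoneOn (fun x => h x / (1 - cdf H x)) (Ico (0 : ℝ) 1)

/-- The virtual value `ψ_H(x) = x - (1 - H(x)) / h(x)`. It is extended-real valued, so that it is
`-∞` where `h(x) = 0 < 1 - H(x)` (under an increasing hazard rate with full support this can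
happen only at `x = 0`), and `ψ_H(1) = 1` whatever the value `h(1)`. -/
def virtualValue (H : Measure ℝ) (h : ℝ → ℝ) (x : ℝ) : EReal :=
  (x : EReal) - ((ENNReal.ofReal (1 - cdf H x) / ENNReal.ofReal (h x) : ℝ≥0∞) : EReal)

/-- The inverse `ψ_H⁻¹` of the strictly increasing function `ψ_H` on `[0,1]`. If `ψ_H` is
discontinuous and jumps over `y`, the value is the point of the jump. -/
def virtualInv (H : Measure ℝ) (h : ℝ → ℝ) (y : EReal) : ℝ :=
  sInf {x ∈ Icc (0 : ℝ) 1 | y ≤ virtualValue H h x}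

/-- Gains from trade: `F(v | v ≥ p) ≤ G(v | v ≥ p)` for all `p ∈ [0,1]` and `v ≥ p`. -/
def GainsFromTrade (F G : Measure ℝ) : Prop :=
  ∀ p ∈ Icc (0 : ℝ) 1, ∀ v, p ≤ v → cond F (Ici p) (Iic v) ≤ cond G (Ici p) (Iic v)

/-! ### Outcomes and payoffs -/

/-- Outcomes `((q₁, q₂), (t₁, t₂))`: `q₁`, `q₂` are the probabilities that the intermediary,
respectively the consumer, ends up with the good (the seller has it otherwise), and `t₁`, `t₂` are
their net payments, all of which go to the seller. -/
abbrev Outcome : Type :=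
  {x : (ℝ × ℝ) × (ℝ × ℝ) // 0 ≤ x.1.1 ∧ 0 ≤ x.1.2 ∧ x.1.1 + x.1.2 ≤ 1}

def q₁ (x : Outcome) : ℝ := x.1.1.1
def q₂ (x : Outcome) : ℝ := x.1.1.2
def t₁ (x : Outcome) : ℝ := x.1.2.1
def t₂ (x : Outcome) : ℝ := x.1.2.2

/-- Utility of the intermediary (the delegate) of type `θ₁`. -/
def u₁ (x : Outcome) (θ₁ : ℝ) : ℝ := θ₁ * q₁ x - t₁ x

/-- Utility of the consumer (the agent) of type `θ₂`. -/
def u₂ (x : Outcome) (θ₂ : ℝ) : ℝ := θ₂ * q₂ x - t₂ x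

/-- The default outcome: the seller keeps the good and nobody pays. -/
def noTrade : Outcome := ⟨((0, 0), (0, 0)), by norm_num⟩

/-! ### The delegation game

Contractual rights are a family `C : Λ → Set Outcome` of admissible menus. The delegate picks an
element of `Λ ⊕ Unit`: either a menu `C l`, or `Sum.inr ()`, which is opting out. -/

section Game

variable {Λ : Type} [MeasurableSpace Λ]

/-- The menus the delegate can choose from: `{C l}` together with the opt-out menu `{noTrade}`. -/
def fullMenu (C : Λ → Set Outcome) : Λ ⊕ Unit → Set Outcome :=
  Sum.elim C (fun _ => {noTrade})

variable (Λ) in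
/-- A profile of (mixed) strategies and beliefs: `choice θ₁` is the delegate's lottery over menus,
`response (m, θ₂)` is the agent's lottery over outcomes when offered the menu `m`, and `belief m`
is the agent's belief about `θ₁` when offered `m`. -/
structure Profile where
  choice : Kernel ℝ (Λ ⊕ Unit)
  response : Kernel ((Λ ⊕ Unit) × ℝ) Outcome
  belief : Kernel (Λ ⊕ Unit) ℝ
  choice_markov : IsMarkovKernel choice
  response_markov : IsMarkovKernel response
  belief_markov : IsMarkovKernel belief

namespace Profile

variable (e : Profile Λ) (F G : Measure ℝ)

/-- The law of the outcome if the menu `m` is offered to an agent of random type `θ₂ ~ F`. -/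
def menuLaw (m : Λ ⊕ Unit) : Measure Outcome :=
  F.bind (fun θ₂ => e.response (m, θ₂))

/-- Expected payoff of the delegate of type `θ₁` from offering the menu `m`. -/
def delegatePayoff (θ₁ : ℝ) (m : Λ ⊕ Unit) : ℝ := ∫ x, u₁ x θ₁ ∂(e.menuLaw F m)

/-- Expected payoff of the agent of type `θ₂` when offered the menu `m`, given his belief about
the delegate's type. -/
def agentPayoff (m : Λ ⊕ Unit) (θ₂ : ℝ) : ℝ :=
  ∫ _θ₁, (∫ x, u₂ x θ₂ ∂(e.response (m, θ₂))) ∂(e.belief m)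

/-- `e` is a perfect Bayesian equilibrium given the contractual rights `C`, when `θ₁ ~ G` and
`θ₂ ~ F` are independent. The integrability clauses say that the expected payoffs compared are
well defined. Optimality among pure deviations is the same as optimality among lotteries. -/
structure IsEquilibrium (C : Λ → Set Outcome) : Prop where
  /-- the agent chooses from the menu offered or opts out -/
  response_mem : ∀ m, ∀ θ₂ ∈ Icc (0 : ℝ) 1,
    ∀ᵐ x ∂(e.response (m, θ₂)), x ∈ insert noTrade (fullMenu C m)
  belief_mem : ∀ m, ∀ᵐ θ₁ ∂(e.belief m), θ₁ ∈ Icc (0 : ℝ) 1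
  agent_integrable : ∀ m, ∀ θ₂ ∈ Icc (0 : ℝ) 1, Integrable t₂ (e.response (m, θ₂))
  /-- the agent's choice is optimal after every menu -/
  agent_optimal : ∀ m, ∀ θ₂ ∈ Icc (0 : ℝ) 1, ∀ y ∈ insert noTrade (fullMenu C m),
    u₂ y θ₂ ≤ e.agentPayoff m θ₂
  delegate_integrable : ∀ m, Integrable t₁ (e.menuLaw F m)
  delegate_integrable' : ∀ θ₁ ∈ Icc (0 : ℝ) 1, Integrable (e.delegatePayoff F θ₁) (e.choice θ₁)
  /-- the delegate's choice is optimal for every type -/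
  delegate_optimal : ∀ θ₁ ∈ Icc (0 : ℝ) 1, ∀ m,
    e.delegatePayoff F θ₁ m ≤ ∫ m', e.delegatePayoff F θ₁ m' ∂(e.choice θ₁)
  /-- Bayes' rule: the joint law of `(m, θ₁)` is recovered from the law of `m` and the beliefs -/
  bayes : (G ⊗ₘ e.choice).map Prod.swap = (G.bind e.choice) ⊗ₘ e.belief

/-- The (random) social choice function induced by the profile. -/
def outcome (θ₁ θ₂ : ℝ) : Measure Outcome :=
  (e.choice θ₁).bind (fun m => e.response (m, θ₂))

/-- The ex-ante law of the outcome, for independent `θ₁ ~ G` and `θ₂ ~ F`. -/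
def outcomeLaw : Measure Outcome := ((G.bind e.choice).prod F).bind e.response

/-- Expected transfers exist. -/
def FiniteTransfers : Prop :=
  Integrable t₁ (e.outcomeLaw F G) ∧ Integrable t₂ (e.outcomeLaw F G)

/-- The seller's expected revenue. -/
def revenue : ℝ := ∫ x, (t₁ x + t₂ x) ∂(e.outcomeLaw F G)

/-- No buybacks: the total allocation to intermediary and consumer depends on the intermediary's
type only, so it is settled when he contracts with the seller, whatever happens at the resale
stage. -/
def NoBuyback : Prop :=
  ∃ γ : ℝ → ℝ, ∀ θ₁ ∈ Icc (0 : ℝ) 1, ∀ θ₂ ∈ Icc (0 : ℝ) 1,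
    ∫ x, (q₁ x + q₂ x) ∂(e.outcome θ₁ θ₂) = γ θ₁

end Profile

end Game

/-- The revenues the seller can obtain in equilibrium by some choice of contractual rights, with no
restriction (so buybacks are possible). -/
def delegationRevenues (F G : Measure ℝ) : Set ℝ :=
  {R | ∃ (Λ : Type) (_ : MeasurableSpace Λ) (C : Λ → Set Outcome) (e : Profile Λ),
    e.IsEquilibrium F G C ∧ e.FiniteTransfers F G ∧ R = e.revenue F G}

/-- The revenues the seller can obtain in equilibrium by some choice of contractual rights when
buybacks are forbidden. -/
def noBuybackRevenues (F G : Measure ℝ) : Set ℝ :=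
  {R | ∃ (Λ : Type) (_ : MeasurableSpace Λ) (C : Λ → Set Outcome) (e : Profile Λ),
    e.IsEquilibrium F G C ∧ e.FiniteTransfers F G ∧ e.NoBuyback ∧ R = e.revenue F G}

/-! ### Price agreements -/

/-- The price agreement with resale price `p` and discounted (wholesale) price `w`: the intermediary
pays `w` to the seller; either the consumer buys the good and pays `p` to the intermediary, or he
does not and the intermediary keeps the good. -/
def priceAgreement (p w : ℝ) : Set Outcome :=
  {⟨((0, 1), (w - p, p)), by norm_num⟩, ⟨((1, 0), (w, 0)), by norm_num⟩}

/-- The lowest resale price `p̂ = ψ_F⁻¹(ψ_G(0))`. -/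
def lowestPrice (F G : Measure ℝ) (f g : ℝ → ℝ) : ℝ :=
  virtualInv F f (virtualValue G g 0)

/-- The discount `d(p) = p F(p) - ∫_{p̂}^p ψ_G⁻¹(ψ_F(x)) f(x) dx`. -/
def discount (F G : Measure ℝ) (f g : ℝ → ℝ) (p : ℝ) : ℝ :=
  p * cdf F p -
    ∫ x in (lowestPrice F G f g)..p, virtualInv G g (virtualValue F f x) * f x

/-- The family of price agreements with resale prices `p ∈ [p̂, 1]` and discounted prices
`p - d(p)`. -/
def agreements (F G : Measure ℝ) (f g : ℝ → ℝ) : Icc (lowestPrice F G f g) 1 → Set Outcome :=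
  fun p => priceAgreement p (p - discount F G f g p)

end Resale

end

open Resale

namespace Resale

open Filter Topology

/-! The proof is Myersonian. In any equilibrium both players face incentive compatible mechanisms:
the consumer within each menu, the intermediary across lotteries over menus. The envelope formula
turns expected payments into virtual values, so revenue is the mean of `ψ_G(θ₁) Q₁ + ψ_F(θ₂) Q₂`
plus the payments of the lowest types, which are at most zero because both can opt out
(`revenue_eq`, `revenue_le_surplus`).

Without buybacks `Q₁ + Q₂ = γ(θ₁)`, so the inner mean over `θ₂` is at most `γ(θ₁) E max(ψ_G(θ₁),
ψ_F)`. That mean of the maximum is nonnegative because `ψ_F` has mean zero, hence `γ = 1` is best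
and revenue is at most `maxSurplus`. The price agreements attain this bound: type `θ₁` gains `θ₁ -
ψ_G⁻¹(ψ_F(x))` per unit of `F`-mass when the resale price passes `x`, and this changes sign at
`ψ_F⁻¹(ψ_G(θ₁))` (`pricePayoff_le`). The good thus goes to the larger virtual value, and the lowest
types pay zero (`revenue_price`).

With buybacks, virtual surplus is at most `E max(ψ_G, 0) + E max(ψ_F, 0)`. Each term is the revenue
of a posted price, to the intermediary or to the consumer. By gains from trade the first price sells
at least as often to the consumer, and any posted price to the consumer earns at most `maxSurplus`
(`price_revenue_le_maxSurplus`). This gives the factor two. Gains from trade also yield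
`ψ_G⁻¹(ψ_F(x)) ≤ x`, which makes the discounts nonnegative. -/

/-- The real-valued expression for the virtual value, meaningful on `(0,1)`. -/
noncomputable def virtualReal (H : Measure ℝ) (h : ℝ → ℝ) (x : ℝ) : ℝ := x - (1 - cdf H x) / h x

/-! ### Type laws: distribution function, density, virtual value -/

namespace IsTypeLaw

variable {H : Measure ℝ} {h : ℝ → ℝ}

lemma absolutelyContinuous (hH : IsTypeLaw H h) : H ≪ volume.restrict (Icc (0 : ℝ) 1) := by
  rw [hH.eq_withDensity]
  exact withDensity_absolutelyContinuous _ _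

lemma nullSingletonClass (hH : IsTypeLaw H h) : NullSingletonClass H :=
  ⟨fun x => hH.absolutelyContinuous (by simp)⟩

lemma ae_mem_Icc (hH : IsTypeLaw H h) : ∀ᵐ x ∂H, x ∈ Icc (0 : ℝ) 1 :=
  hH.absolutelyContinuous.ae_le (ae_restrict_mem measurableSet_Icc)

lemma ae_mem_Ioo (hH : IsTypeLaw H h) : ∀ᵐ x ∂H, x ∈ Ioo (0 : ℝ) 1 := by
  have := hH.nullSingletonClass
  filter_upwards [hH.ae_mem_Icc, Measure.ae_ne H 0, Measure.ae_ne H 1] with x hx h0 h1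
  exact ⟨lt_of_le_of_ne hx.1 (Ne.symm h0), lt_of_le_of_ne hx.2 h1⟩

lemma apply_eq (hH : IsTypeLaw H h) {s : Set ℝ} (hs : MeasurableSet s) :
    H s = ∫⁻ x in s ∩ Icc 0 1, ENNReal.ofReal (h x) := by
  conv_lhs => rw [hH.eq_withDensity]
  rw [withDensity_apply _ hs, Measure.restrict_restrict hs]

lemma integrableOn_density (hH : IsTypeLaw H h) : IntegrableOn h (Icc 0 1) := by
  have := hH.isProb
  refine ⟨hH.measurable_density.aestronglyMeasurable, ?_⟩
  rw [hasFiniteIntegral_iff_ofReal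
    ((ae_restrict_iff' measurableSet_Icc).2 (.of_forall hH.density_nonneg))]
  have := hH.apply_eq MeasurableSet.univ
  rw [univ_inter] at this
  rw [← this]
  exact measure_lt_top _ _

lemma integral_eq (hH : IsTypeLaw H h) (φ : ℝ → ℝ) :
    ∫ x, φ x ∂H = ∫ x in Icc 0 1, h x * φ x := by
  conv_lhs => rw [hH.eq_withDensity]
  rw [integral_withDensity_eq_integral_toReal_smul (hH.measurable_density.ennreal_ofReal)
    (by simp)]
  refine setIntegral_congr_fun measurableSet_Icc fun x hx => ?_
  simp [ENNReal.toReal_ofReal (hH.density_nonneg x hx)]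

lemma integrable_iff (hH : IsTypeLaw H h) (φ : ℝ → ℝ) :
    Integrable φ H ↔ IntegrableOn (fun x => h x * φ x) (Icc 0 1) := by
  conv_lhs => rw [hH.eq_withDensity]
  rw [integrable_withDensity_iff_integrable_smul' hH.measurable_density.ennreal_ofReal (by simp)]
  refine integrableOn_congr_fun (fun x hx => ?_) measurableSet_Icc
  simp [ENNReal.toReal_ofReal (hH.density_nonneg x hx)]

lemma cdf_sub (hH : IsTypeLaw H h) {x y : ℝ} (hx : 0 ≤ x) (hxy : x ≤ y) (hy : y ≤ 1) :
    cdf H y - cdf H x = ∫ s in Ioc x y, h s := by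
  have := hH.isProb
  have hsub : Ioc x y ⊆ Icc 0 1 := fun s hs => ⟨hx.trans hs.1.le, hs.2.trans hy⟩
  have h1 : H.real (Ioc x y) = cdf H y - cdf H x := by
    rw [cdf_eq_real, cdf_eq_real, ← Iic_sdiff_Iic, measureReal_sdiff (Iic_subset_Iic.2 hxy)
      measurableSet_Iic]
  rw [← h1, measureReal_def, hH.apply_eq measurableSet_Ioc, inter_eq_left.2 hsub,
    integral_eq_lintegral_of_nonneg_ae _ hH.measurable_density.aestronglyMeasurable]
  exact (ae_restrict_iff' measurableSet_Ioc).2 (.of_forall fun s hs => hH.density_nonneg s (hsub hs))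

lemma cdf_zero (hH : IsTypeLaw H h) : cdf H 0 = 0 := by
  have := hH.isProb
  have := hH.nullSingletonClass
  rw [cdf_eq_real, measureReal_eq_zero_iff]
  have h2 : H (Ioo (0 : ℝ) 1)ᶜ = 0 := hH.ae_mem_Ioo
  refine measure_mono_null (fun x hx => ?_) h2
  simp only [mem_compl_iff, mem_Ioo, not_and]
  intro h3
  exact absurd h3 (not_lt.2 hx)

lemma cdf_one (hH : IsTypeLaw H h) : cdf H 1 = 1 := by
  have := hH.isProb
  rw [cdf_eq_real, measureReal_def, (prob_compl_eq_zero_iff measurableSet_Iic).1, ENNReal.toReal_one]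
  have h2 : H (Icc (0 : ℝ) 1)ᶜ = 0 := hH.ae_mem_Icc
  exact measure_mono_null (fun x hx (h3 : x ∈ Icc (0 : ℝ) 1) => hx h3.2) h2

lemma cdf_mono (H : Measure ℝ) {x y : ℝ} (hxy : x ≤ y) : cdf H x ≤ cdf H y :=
  monotone_cdf H hxy

lemma measure_Ioo_pos (hH : IsTypeLaw H h) {x y : ℝ} (hx : 0 ≤ x) (hxy : x < y) (hy : y ≤ 1) :
    0 < H (Ioo x y) := by
  have hm : (x + y) / 2 ∈ H.support := by
    rw [hH.full_support]; constructor <;> linarith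
  exact Measure.mem_support_iff_forall _ |>.1 hm _ (Ioo_mem_nhds (by linarith) (by linarith))

lemma cdf_lt (hH : IsTypeLaw H h) {x y : ℝ} (hx : 0 ≤ x) (hxy : x < y) (hy : y ≤ 1) :
    cdf H x < cdf H y := by
  have := hH.isProb
  have h1 : H.real (Ioc x y) = cdf H y - cdf H x := by
    rw [cdf_eq_real, cdf_eq_real, ← Iic_sdiff_Iic, measureReal_sdiff (Iic_subset_Iic.2 hxy.le)
      measurableSet_Iic]
  have h2 : 0 < H.real (Ioc x y) := by
    rw [measureReal_def, ENNReal.toReal_pos_iff]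
    exact ⟨(hH.measure_Ioo_pos hx hxy hy).trans_le (measure_mono Ioo_subset_Ioc_self),
      measure_lt_top _ _⟩
  linarith

lemma cdf_lt_one (hH : IsTypeLaw H h) {x : ℝ} (hx : x ∈ Ico (0 : ℝ) 1) : cdf H x < 1 :=
  hH.cdf_one ▸ hH.cdf_lt hx.1 hx.2 le_rfl

/-- A zero of the density at `x` would, by monotonicity of the hazard rate, make the density vanish
on all of `(0, x]`, against full support. -/
lemma density_pos (hH : IsTypeLaw H h) {x : ℝ} (hx : x ∈ Ioo (0 : ℝ) 1) : 0 < h x := by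
  refine lt_of_le_of_ne (hH.density_nonneg x ⟨hx.1.le, hx.2.le⟩) fun h0 => ?_
  have hz : ∀ s ∈ Ioc 0 x, h s = 0 := by
    intro s hs
    have hs1 : s ∈ Ico (0 : ℝ) 1 := ⟨hs.1.le, hs.2.trans_lt hx.2⟩
    have h1 := hH.hazard_mono hs1 ⟨hx.1.le, hx.2⟩ hs.2
    simp only [← h0, zero_div] at h1
    have h2 := hH.cdf_lt_one hs1
    have h3 := hH.density_nonneg s ⟨hs.1.le, hs1.2.le⟩
    by_contra h4
    have := div_pos (lt_of_le_of_ne h3 (Ne.symm h4)) (sub_pos.2 h2)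
    linarith
  have h1 := hH.cdf_sub le_rfl hx.1.le hx.2.le
  rw [setIntegral_congr_fun measurableSet_Ioc hz] at h1
  have h2 := hH.cdf_lt le_rfl hx.1 hx.2.le
  simp at h1
  linarith

lemma virtualValue_eq (hH : IsTypeLaw H h) {x : ℝ} (hx : x ∈ Ioo (0 : ℝ) 1) :
    virtualValue H h x = (virtualReal H h x : ℝ) := by
  have h1 := hH.cdf_lt_one ⟨hx.1.le, hx.2⟩
  have h2 := hH.density_pos hx
  rw [virtualValue, virtualReal, ← ENNReal.ofReal_div_of_pos h2, EReal.coe_ennreal_ofReal,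
    max_eq_left (div_nonneg (by linarith) h2.le), EReal.coe_sub]

lemma virtualValue_one (hH : IsTypeLaw H h) : virtualValue H h 1 = 1 := by
  simp [virtualValue, hH.cdf_one]

lemma virtualValue_le (x : ℝ) : virtualValue H h x ≤ x := by
  rw [virtualValue]
  refine EReal.sub_le_of_le_add ?_
  exact le_add_of_nonneg_right (EReal.coe_ennreal_nonneg _)

/-- The subtracted term is the reciprocal of the hazard rate, hence nonincreasing; strictness comes
from the summand `x`. The endpoint `1`, where no hazard rate is given, and a vanishing density,
where the value is `⊥`, are separate cases. -/
lemma virtualValue_strictMonoOn (hH : IsTypeLaw H h) :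
    StrictMonoOn (virtualValue H h) (Icc 0 1) := by
  intro x hx y hy hxy
  have hx1 : x ∈ Ico (0 : ℝ) 1 := ⟨hx.1, hxy.trans_le hy.2⟩
  rcases eq_or_lt_of_le hy.2 with rfl | hy1
  · rw [hH.virtualValue_one]
    exact (virtualValue_le x).trans_lt (by exact_mod_cast hxy)
  have hy2 : y ∈ Ioo (0 : ℝ) 1 := ⟨hx.1.trans_lt hxy, hy1⟩
  rw [hH.virtualValue_eq hy2]
  rcases eq_or_lt_of_le (hH.density_nonneg x hx) with h0 | h0
  · have h1 := hH.cdf_lt_one hx1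
    have : virtualValue H h x = ⊥ := by
      rw [virtualValue, ← h0, ENNReal.ofReal_zero, ENNReal.div_zero (by simpa using h1)]
      simp
    rw [this]
    exact EReal.bot_lt_coe _
  · have h1 := hH.cdf_lt_one hx1
    have e : virtualValue H h x = (virtualReal H h x : ℝ) := by
      rw [virtualValue, virtualReal, ← ENNReal.ofReal_div_of_pos h0, EReal.coe_ennreal_ofReal,
        max_eq_left (div_nonneg (by linarith) h0.le), EReal.coe_sub]
    rw [e, EReal.coe_lt_coe_iff, virtualReal, virtualReal]
    have h2 := hH.hazard_mono hx1 ⟨hy.1, hy1⟩ hxy.le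
    have h3 := one_div_le_one_div_of_le (div_pos h0 (sub_pos.2 h1)) h2
    rw [one_div_div, one_div_div] at h3
    linarith

/-! ### The inverse virtual value -/

lemma bddBelow_setOf (y : EReal) : BddBelow {x ∈ Icc (0 : ℝ) 1 | y ≤ virtualValue H h x} :=
  ⟨0, fun _ hx => hx.1.1⟩

lemma one_mem_setOf (hH : IsTypeLaw H h) {y : EReal} (hy : y ≤ 1) :
    (1 : ℝ) ∈ {x ∈ Icc (0 : ℝ) 1 | y ≤ virtualValue H h x} :=
  ⟨by simp, by rwa [hH.virtualValue_one]⟩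

lemma virtualInv_le {x : ℝ} (hx : x ∈ Icc (0 : ℝ) 1) {y : EReal} (hy : y ≤ virtualValue H h x) :
    virtualInv H h y ≤ x :=
  csInf_le (bddBelow_setOf y) ⟨hx, hy⟩

lemma virtualInv_nonneg (y : EReal) : 0 ≤ virtualInv H h y :=
  Real.sInf_nonneg fun _ hx => hx.1.1

lemma virtualInv_mem (hH : IsTypeLaw H h) {y : EReal} (hy : y ≤ 1) :
    virtualInv H h y ∈ Icc (0 : ℝ) 1 :=
  ⟨virtualInv_nonneg y, csInf_le (bddBelow_setOf y) (hH.one_mem_setOf hy)⟩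

/-- Together with `le_of_virtualInv_lt` this replaces `ψ(ψ⁻¹(y)) = y`, which fails when `ψ` jumps
over `y`. Only the single point `ψ⁻¹(y)` is left undecided, and it has measure zero. -/
lemma lt_of_lt_virtualInv {x : ℝ} (hx : x ∈ Icc (0 : ℝ) 1) {y : EReal}
    (hy : x < virtualInv H h y) : virtualValue H h x < y := by
  by_contra! h1
  exact absurd (virtualInv_le hx h1) (not_le.2 hy)

lemma le_of_virtualInv_lt (hH : IsTypeLaw H h) {x : ℝ} (hx : x ∈ Icc (0 : ℝ) 1) {y : EReal}
    (h1 : y ≤ 1) (hy : virtualInv H h y < x) : y ≤ virtualValue H h x := by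
  obtain ⟨z, hz, hzx⟩ := exists_lt_of_csInf_lt ⟨1, hH.one_mem_setOf h1⟩ hy
  exact hz.2.trans (hH.virtualValue_strictMonoOn.monotoneOn hz.1 hx hzx.le)

lemma virtualInv_mono (hH : IsTypeLaw H h) {y z : EReal} (hyz : y ≤ z) (hz : z ≤ 1) :
    virtualInv H h y ≤ virtualInv H h z :=
  csInf_le_csInf (bddBelow_setOf y) ⟨1, hH.one_mem_setOf hz⟩ fun _ hx => ⟨hx.1, hyz.trans hx.2⟩

lemma virtualInv_virtualValue (hH : IsTypeLaw H h) {x : ℝ} (hx : x ∈ Icc (0 : ℝ) 1) :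
    virtualInv H h (virtualValue H h x) = x := by
  refine le_antisymm (virtualInv_le hx le_rfl) (le_csInf ⟨x, hx, le_rfl⟩ fun z hz => ?_)
  exact (hH.virtualValue_strictMonoOn.le_iff_le hx hz.1).1 hz.2

lemma virtualValue_le_one {x : ℝ} (hx : x ≤ 1) : virtualValue H h x ≤ 1 :=
  (virtualValue_le x).trans (by exact_mod_cast hx)

end IsTypeLaw

/-! ### Consequences of the gains from trade -/

section GainsFromTrade

variable {F G : Measure ℝ} {f g : ℝ → ℝ}

lemma GainsFromTrade.cdf_le (hFG : GainsFromTrade F G) (hF : IsTypeLaw F f) (hG : IsTypeLaw G g)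
    {x v : ℝ} (hx : x ∈ Ico (0 : ℝ) 1) (hv : x ≤ v) :
    (cdf F v - cdf F x) / (1 - cdf F x) ≤ (cdf G v - cdf G x) / (1 - cdf G x) := by
  have key : ∀ {H : Measure ℝ} {h : ℝ → ℝ}, IsTypeLaw H h →
      (cond H (Ici x) (Iic v)).toReal = (cdf H v - cdf H x) / (1 - cdf H x) := by
    intro H h hH
    have := hH.isProb
    have := hH.nullSingletonClass
    rw [cond_apply measurableSet_Ici, Ici_inter_Iic, ENNReal.toReal_mul, ENNReal.toReal_inv,
      ← measureReal_def, ← measureReal_def, ← measureReal_congr Ioc_ae_eq_Icc, ← Iic_sdiff_Iic,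
      measureReal_sdiff (Iic_subset_Iic.2 hv) measurableSet_Iic, ← cdf_eq_real, ← cdf_eq_real,
      ← measureReal_congr Ioi_ae_eq_Ici, ← compl_Iic, probReal_compl_eq_one_sub measurableSet_Iic,
      ← cdf_eq_real]
    ring
  rw [← key hF, ← key hG]
  have := hG.isProb
  have hne : G (Ici x) ≠ 0 := by
    intro h0
    have h1 := hG.measure_Ioo_pos hx.1 hx.2 le_rfl
    exact h1.ne' (measure_mono_null (fun s hs => hs.1.le) h0)
  have := cond_isProbabilityMeasure hne
  exact ENNReal.toReal_mono (measure_ne_top _ _) (hFG x ⟨hx.1, hx.2.le⟩ v hv)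

lemma GainsFromTrade.cdf_le_cdf (hFG : GainsFromTrade F G) (hF : IsTypeLaw F f)
    (hG : IsTypeLaw G g) {v : ℝ} (hv : 0 ≤ v) : cdf F v ≤ cdf G v := by
  simpa [hF.cdf_zero, hG.cdf_zero] using hFG.cdf_le hF hG (x := 0) (by simp) hv

/-- Over a short interval `(x, v]` the conditional mass of `F` is bounded below through its hazard
rate at `x`, and that of `G` above through its hazard rate at `y`; divide by `v - x` and let `v`
decrease to `x`. The gap `x < y` is there because at a jump a monotone hazard rate may take any
value between its one-sided limits. -/
lemma GainsFromTrade.hazard_le (hFG : GainsFromTrade F G) (hF : IsTypeLaw F f)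
    (hG : IsTypeLaw G g) {x y : ℝ} (hx : 0 ≤ x) (hxy : x < y) (hy : y < 1) :
    f x / (1 - cdf F x) ≤ g y / (1 - cdf G y) := by
  have hx1 : x ∈ Ico (0 : ℝ) 1 := ⟨hx, hxy.trans hy⟩
  have hFx := hF.cdf_lt_one hx1
  have hGx := hG.cdf_lt_one hx1
  have step : ∀ v ∈ Ioo x y, f x / (1 - cdf F x) * (1 - cdf F v) ≤
      g y / (1 - cdf G y) * (1 - cdf F x) := by
    intro v hv
    have hv1 : v < 1 := hv.2.trans hy
    have hvx : 0 < v - x := sub_pos.2 hv.1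
    -- The density is the hazard rate times the survival function; on `(x, v]` these are at least
    -- their values at `x` and at `v` respectively.
    have a1 : f x / (1 - cdf F x) * (1 - cdf F v) * (v - x) ≤ cdf F v - cdf F x := by
      rw [hF.cdf_sub hx hv.1.le hv1.le]
      have h0 : ∫ s in Ioc x v, f x / (1 - cdf F x) * (1 - cdf F v) ≤ ∫ s in Ioc x v, f s := by
        refine setIntegral_mono_on continuous_const.integrableOn_Ioc (hF.integrableOn_density.mono_set
          fun s hs => ⟨hx.trans hs.1.le, hs.2.trans hv1.le⟩) measurableSet_Ioc fun s hs => ?_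
        have hs1 : s ∈ Ico (0 : ℝ) 1 := ⟨hx.trans hs.1.le, hs.2.trans_lt hv1⟩
        have h1 := hF.hazard_mono hx1 hs1 hs.1.le
        have h2 := hF.cdf_lt_one hs1
        have h3 : 1 - cdf F v ≤ 1 - cdf F s := by
          have := IsTypeLaw.cdf_mono F hs.2
          linarith
        have h4 := hF.cdf_lt_one (x := v) ⟨hx.trans hv.1.le, hv1⟩
        calc _ ≤ f s / (1 - cdf F s) * (1 - cdf F s) := by
              refine mul_le_mul h1 h3 (by linarith) ?_
              exact div_nonneg (hF.density_nonneg s ⟨hs1.1, hs1.2.le⟩) (by linarith)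
          _ = f s := div_mul_cancel₀ _ (by linarith)
      rw [setIntegral_const, Real.volume_real_Ioc_of_le hv.1.le, smul_eq_mul] at h0
      linarith
    have a2 : cdf G v - cdf G x ≤ g y / (1 - cdf G y) * (1 - cdf G x) * (v - x) := by
      rw [hG.cdf_sub hx hv.1.le hv1.le]
      have h0 : ∫ s in Ioc x v, g s ≤ ∫ s in Ioc x v, g y / (1 - cdf G y) * (1 - cdf G x) := by
        refine setIntegral_mono_on (hG.integrableOn_density.mono_set
          fun s hs => ⟨hx.trans hs.1.le, hs.2.trans hv1.le⟩) continuous_const.integrableOn_Ioc measurableSet_Ioc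
          fun s hs => ?_
        have hs1 : s ∈ Ico (0 : ℝ) 1 := ⟨hx.trans hs.1.le, hs.2.trans_lt hv1⟩
        have hy1 : y ∈ Ico (0 : ℝ) 1 := ⟨hx.trans hxy.le, hy⟩
        have h1 := hG.hazard_mono hs1 hy1 (hs.2.trans hv.2.le)
        have h2 := hG.cdf_lt_one hs1
        have h3 : 1 - cdf G s ≤ 1 - cdf G x := by
          have := IsTypeLaw.cdf_mono G hs.1.le
          linarith
        have h4 := hG.cdf_lt_one hy1
        calc g s = g s / (1 - cdf G s) * (1 - cdf G s) := (div_mul_cancel₀ _ (by linarith)).symm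
          _ ≤ _ := by
              refine mul_le_mul h1 h3 (by linarith) ?_
              exact div_nonneg (hG.density_nonneg y ⟨hy1.1, hy1.2.le⟩) (by linarith)
      rw [setIntegral_const, Real.volume_real_Ioc_of_le hv.1.le, smul_eq_mul] at h0
      linarith
    have a3 := hFG.cdf_le hF hG hx1 hv.1.le
    rw [div_le_div_iff₀ (by linarith) (by linarith)] at a3
    have a4 : f x / (1 - cdf F x) * (1 - cdf F v) * (v - x) * (1 - cdf G x) ≤
        g y / (1 - cdf G y) * (1 - cdf G x) * (v - x) * (1 - cdf F x) :=
      (mul_le_mul_of_nonneg_right a1 (by linarith)).trans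
        (a3.trans (mul_le_mul_of_nonneg_right a2 (by linarith)))
    have a5 : 0 < (v - x) * (1 - cdf G x) := mul_pos hvx (by linarith)
    refine le_of_mul_le_mul_right ?_ a5
    linarith
  -- Right continuity of the distribution function removes the error factor `1 - cdf F v`.
  have hlim : Tendsto (fun v => f x / (1 - cdf F x) * (1 - cdf F v)) (𝓝[>] x)
      (𝓝 (f x / (1 - cdf F x) * (1 - cdf F x))) := by
    have h1 : Tendsto (cdf F : ℝ → ℝ) (𝓝[>] x) (𝓝 (cdf F x)) :=
      ((cdf F).right_continuous x).mono_left (nhdsWithin_mono _ Ioi_subset_Ici_self)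
    exact (h1.const_sub 1).const_mul _
  have h2 := le_of_tendsto hlim
    (eventually_of_mem (Ioo_mem_nhdsGT hxy) step)
  exact le_of_mul_le_mul_right h2 (by linarith)

lemma GainsFromTrade.virtualValue_le (hFG : GainsFromTrade F G) (hF : IsTypeLaw F f)
    (hG : IsTypeLaw G g) {x y : ℝ} (hx : 0 ≤ x) (hxy : x < y) (hy : y < 1) :
    virtualValue F f x ≤ virtualValue G g y := by
  have hx1 : x ∈ Ico (0 : ℝ) 1 := ⟨hx, hxy.trans hy⟩
  have hy1 : y ∈ Ioo (0 : ℝ) 1 := ⟨hx.trans_lt hxy, hy⟩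
  have hFx := hF.cdf_lt_one hx1
  have hGy := hG.cdf_lt_one ⟨hy1.1.le, hy⟩
  have h1 := hFG.hazard_le hF hG hx hxy hy
  have hg := hG.density_pos hy1
  rw [hG.virtualValue_eq hy1, virtualReal, virtualValue]
  rcases eq_or_lt_of_le (hF.density_nonneg x ⟨hx, hx1.2.le⟩) with h0 | h0
  · rw [← h0, ENNReal.ofReal_zero, ENNReal.div_zero (by simpa using hFx)]
    simp
  · rw [← ENNReal.ofReal_div_of_pos h0, EReal.coe_ennreal_ofReal,
      max_eq_left (div_nonneg (by linarith) h0.le), ← EReal.coe_sub, EReal.coe_le_coe_iff]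
    have h3 := one_div_le_one_div_of_le (div_pos h0 (sub_pos.2 hFx)) h1
    rw [one_div_div, one_div_div] at h3
    linarith

/-- Every `y` in `(x, 1)` satisfies `ψ_F(x) ≤ ψ_G(y)`; let `y` decrease to `x`. -/
lemma GainsFromTrade.virtualInv_le (hFG : GainsFromTrade F G) (hF : IsTypeLaw F f)
    (hG : IsTypeLaw G g) {x : ℝ} (hx : x ∈ Icc (0 : ℝ) 1) :
    virtualInv G g (virtualValue F f x) ≤ x := by
  rcases eq_or_lt_of_le hx.2 with rfl | hx1
  · exact (hG.virtualInv_mem (IsTypeLaw.virtualValue_le_one le_rfl)).2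
  · refine le_of_forall_gt_imp_ge_of_dense fun y hy => ?_
    rcases lt_or_ge y 1 with h1 | h1
    · exact IsTypeLaw.virtualInv_le ⟨hx.1.trans hy.le, h1.le⟩
        (hFG.virtualValue_le hF hG hx.1 hy h1)
    · exact (hG.virtualInv_mem (IsTypeLaw.virtualValue_le_one hx.2)).2.trans h1

end GainsFromTrade

/-! ### Incentive compatibility and the envelope formula -/

/-- A direct mechanism on `[0,1]` with allocation `Q` and payment `T` in which no type gains by
reporting another. -/
structure IncentiveCompatible (Q T : ℝ → ℝ) : Prop where
  mem_Icc : ∀ x ∈ Icc (0 : ℝ) 1, Q x ∈ Icc (0 : ℝ) 1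
  le : ∀ x ∈ Icc (0 : ℝ) 1, ∀ y ∈ Icc (0 : ℝ) 1, x * Q y - T y ≤ x * Q x - T x

/-- On `n + 1` equal pieces the bounds telescope to `x (Q x - Q 0) / (n + 1)`, which tends to zero.
This gives the envelope formula without differentiating anything. -/
lemma eq_of_abs_sub_le_mul {W Q : ℝ → ℝ} {x : ℝ} (hx : 0 ≤ x)
    (hW : ∀ y ∈ Icc 0 x, ∀ z ∈ Icc 0 x, y ≤ z → |W z - W y| ≤ (z - y) * (Q z - Q y)) :
    W x = W 0 := by
  have key : ∀ n : ℕ, |W x - W 0| ≤ x * (Q x - Q 0) * (1 / ((n : ℝ) + 1)) := by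
    intro n
    have hn : (0 : ℝ) < n + 1 := by positivity
    set c : ℕ → ℝ := fun i => x * (i / (n + 1)) with hc
    have h0 : c 0 = 0 := by simp [hc]
    have h1 : c (n + 1) = x := by simp [hc, div_self hn.ne']
    have hmem : ∀ i ≤ n + 1, c i ∈ Icc 0 x := by
      intro i hi
      have h2 : (i : ℝ) / (n + 1) ≤ 1 := by
        rw [div_le_one hn]; exact_mod_cast hi
      exact ⟨by positivity, mul_le_of_le_one_right hx h2⟩
    have hstep : ∀ i, c (i + 1) - c i = x * (1 / (n + 1)) := by
      intro i
      simp only [hc]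
      push_cast
      field_simp
      ring
    calc |W x - W 0| = |∑ i ∈ Finset.range (n + 1), (W (c (i + 1)) - W (c i))| := by
          rw [Finset.sum_range_sub (fun i => W (c i)), h0, h1]
      _ ≤ ∑ i ∈ Finset.range (n + 1), |W (c (i + 1)) - W (c i)| := Finset.abs_sum_le_sum_abs _ _
      _ ≤ ∑ i ∈ Finset.range (n + 1), x * (1 / (n + 1)) * (Q (c (i + 1)) - Q (c i)) := by
          refine Finset.sum_le_sum fun i hi => ?_
          have hi' : i + 1 ≤ n + 1 := Finset.mem_range.1 hi
          have h3 : c i ≤ c (i + 1) := by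
            have := hstep i
            have : 0 ≤ x * (1 / ((n : ℝ) + 1)) := by positivity
            linarith
          have h2 := hW _ (hmem i (by omega)) _ (hmem (i + 1) hi') h3
          rwa [hstep] at h2
      _ = x * (Q x - Q 0) * (1 / (n + 1)) := by
          rw [← Finset.mul_sum, Finset.sum_range_sub (fun i => Q (c i)), h0, h1]
          ring
  have hlim := (tendsto_one_div_add_atTop_nhds_zero_nat (𝕜 := ℝ)).const_mul (x * (Q x - Q 0))
  rw [mul_zero] at hlim
  have := ge_of_tendsto' hlim key
  have h4 := abs_nonpos_iff.1 this
  linarith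

namespace IncentiveCompatible

variable {Q T : ℝ → ℝ}

lemma monotoneOn (hQ : IncentiveCompatible Q T) : MonotoneOn Q (Icc 0 1) := by
  intro x hx y hy hxy
  rcases eq_or_lt_of_le hxy with rfl | hlt
  · rfl
  have h1 := hQ.le x hx y hy
  have h2 := hQ.le y hy x hx
  nlinarith

lemma integrableOn (hQ : IncentiveCompatible Q T) : IntegrableOn Q (Icc 0 1) :=
  hQ.monotoneOn.integrableOn_isCompact isCompact_Icc

lemma intervalIntegrable (hQ : IncentiveCompatible Q T) {x y : ℝ} (hx : x ∈ Icc (0 : ℝ) 1)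
    (hy : y ∈ Icc (0 : ℝ) 1) : IntervalIntegrable Q volume x y :=
  (hQ.integrableOn.mono_set (uIcc_subset_Icc hx hy)).intervalIntegrable

/-- The envelope formula. -/
lemma envelope (hQ : IncentiveCompatible Q T) {x : ℝ} (hx : x ∈ Icc (0 : ℝ) 1) :
    x * Q x - T x = -T 0 + ∫ s in (0 : ℝ)..x, Q s := by
  have h0 : (0 : ℝ) ∈ Icc (0 : ℝ) 1 := by simp
  have := eq_of_abs_sub_le_mul (W := fun x => x * Q x - T x - ∫ s in (0 : ℝ)..x, Q s) (Q := Q)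
    hx.1 ?_
  · simp only [intervalIntegral.integral_same] at this
    linarith
  intro y hy z hz hyz
  have hy1 : y ∈ Icc (0 : ℝ) 1 := ⟨hy.1, hy.2.trans hx.2⟩
  have hz1 : z ∈ Icc (0 : ℝ) 1 := ⟨hz.1, hz.2.trans hx.2⟩
  have e := intervalIntegral.integral_interval_sub_left (hQ.intervalIntegrable h0 hz1)
    (hQ.intervalIntegrable h0 hy1)
  have hsub : ∀ s ∈ Icc y z, s ∈ Icc (0 : ℝ) 1 := fun s hs => ⟨hy.1.trans hs.1, hs.2.trans hz1.2⟩
  -- The integral of `Q` and the increment of utility both lie between `(z - y) Q y` and `(z - y) Q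
  -- z`, so they differ by at most `(z - y) (Q z - Q y)`.
  have lo : Q y * (z - y) ≤ ∫ s in y..z, Q s := by
    have := intervalIntegral.integral_mono_on hyz (f := fun _ => Q y) (by simp)
      (hQ.intervalIntegrable hy1 hz1) fun s hs => hQ.monotoneOn hy1 (hsub s hs) hs.1
    simpa [mul_comm] using this
  have hi : ∫ s in y..z, Q s ≤ Q z * (z - y) := by
    have := intervalIntegral.integral_mono_on hyz (g := fun _ => Q z)
      (hQ.intervalIntegrable hy1 hz1) (by simp) fun s hs => hQ.monotoneOn (hsub s hs) hz1 hs.2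
    simpa [mul_comm] using this
  have i1 := hQ.le z hz1 y hy1
  have i2 := hQ.le y hy1 z hz1
  rw [abs_le]
  constructor <;> nlinarith

end IncentiveCompatible

/-! ### Expected payments as expected virtual surplus -/

namespace IsTypeLaw

variable {H : Measure ℝ} {h : ℝ → ℝ}

lemma integrable_of_bdd (hH : IsTypeLaw H h) {φ : ℝ → ℝ} {c : ℝ}
    (hφ : AEStronglyMeasurable φ (volume.restrict (Icc 0 1)))
    (hc : ∀ x ∈ Icc (0 : ℝ) 1, |φ x| ≤ c) : Integrable φ H := by
  have := hH.isProb
  refine Integrable.of_bound (hφ.mono_ac hH.absolutelyContinuous) c ?_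
  filter_upwards [hH.ae_mem_Icc] with x hx using hc x hx

lemma integrable_of_monotoneOn (hH : IsTypeLaw H h) {φ : ℝ → ℝ} (hφ : MonotoneOn φ (Icc 0 1)) :
    Integrable φ H := by
  refine hH.integrable_of_bdd (c := max |φ 0| |φ 1|)
    (hφ.integrableOn_isCompact isCompact_Icc).aestronglyMeasurable fun x hx => ?_
  have h0 := hφ (by simp) hx hx.1
  have h1 := hφ hx (by simp) hx.2
  exact abs_le_max_abs_abs h0 h1

lemma integrableOn_one_sub_cdf_mul (H : Measure ℝ) {Q : ℝ → ℝ} (hQ : IntegrableOn Q (Icc 0 1)) :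
    IntegrableOn (fun s => (1 - cdf H s) * Q s) (Icc 0 1) := by
  refine hQ.bdd_mul (c := 1) ?_ (.of_forall fun s => ?_)
  · exact (measurable_const.sub (monotone_cdf H).measurable).aestronglyMeasurable
  · have h0 := cdf_nonneg H s
    have h1 := cdf_le_one H s
    rw [Real.norm_eq_abs, abs_le]
    constructor <;> linarith

/-- Fubini on the triangle `s ≤ x`: without atoms, the mass of types at least `s` is `1 - cdf H s`.
-/
lemma integral_integral_eq (hH : IsTypeLaw H h) {Q : ℝ → ℝ} (hQ : IntegrableOn Q (Icc 0 1)) :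
    Integrable (fun x => ∫ s in (0 : ℝ)..x, Q s) H ∧
    ∫ x, (∫ s in (0 : ℝ)..x, Q s) ∂H = ∫ s in Icc 0 1, (1 - cdf H s) * Q s := by
  have := hH.isProb
  have := hH.nullSingletonClass
  have hS : MeasurableSet {p : ℝ × ℝ | p.2 ≤ p.1} := measurableSet_le measurable_snd measurable_fst
  have hint : Integrable ({p : ℝ × ℝ | p.2 ≤ p.1}.indicator fun p => Q p.2)
      (H.prod (volume.restrict (Icc 0 1))) := (Integrable.comp_snd (μ := H) hQ).indicator hS
  have e1 : ∀ x ∈ Icc (0 : ℝ) 1,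
      ∫ s in Icc (0 : ℝ) 1, {p : ℝ × ℝ | p.2 ≤ p.1}.indicator (fun p => Q p.2) (x, s) =
        ∫ s in (0 : ℝ)..x, Q s := by
    intro x hx
    rw [intervalIntegral.integral_of_le hx.1, ← integral_Icc_eq_integral_Ioc]
    have : (fun s => {p : ℝ × ℝ | p.2 ≤ p.1}.indicator (fun p => Q p.2) (x, s)) =
        (Iic x).indicator Q := by
      ext s; simp [indicator]
    have e2 : Icc (0 : ℝ) 1 ∩ Iic x = Icc 0 x := by
      ext s
      simp only [mem_inter_iff, mem_Icc, mem_Iic]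
      exact ⟨fun hs => ⟨hs.1.1, hs.2⟩, fun hs => ⟨⟨hs.1, hs.2.trans hx.2⟩, hs.2⟩⟩
    rw [this, setIntegral_indicator measurableSet_Iic, e2]
  have e1' : (fun x => ∫ s in Icc (0 : ℝ) 1,
      {p : ℝ × ℝ | p.2 ≤ p.1}.indicator (fun p => Q p.2) (x, s)) =ᵐ[H]
        fun x => ∫ s in (0 : ℝ)..x, Q s := by
    filter_upwards [hH.ae_mem_Icc] with x hx using e1 x hx
  refine ⟨hint.integral_prod_left.congr e1', ?_⟩
  rw [← integral_congr_ae e1', integral_integral_swap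
    (f := fun x s => {p : ℝ × ℝ | p.2 ≤ p.1}.indicator (fun p => Q p.2) (x, s)) hint]
  refine integral_congr_ae (.of_forall fun s => ?_)
  have : (fun x => {p : ℝ × ℝ | p.2 ≤ p.1}.indicator (fun p => Q p.2) (x, s)) =
        (Ici s).indicator (fun _ => Q s) := by
      ext s; simp [indicator]
  simp only [this]
  rw [integral_indicator measurableSet_Ici, setIntegral_const, smul_eq_mul,
    ← measureReal_congr Ioi_ae_eq_Ici, ← compl_Iic, probReal_compl_eq_one_sub measurableSet_Iic,
    ← cdf_eq_real]

/-- Multiplying by the density cancels the denominator of the virtual value, so integrability holds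
even if the virtual value is unbounded near `0`. -/
lemma integrable_virtualReal_mul (hH : IsTypeLaw H h) {Q : ℝ → ℝ}
    (hQ : IntegrableOn Q (Icc 0 1)) (hxQ : Integrable (fun x => x * Q x) H) :
    Integrable (fun x => virtualReal H h x * Q x) H ∧
      ∫ x, virtualReal H h x * Q x ∂H =
        ∫ x, x * Q x ∂H - ∫ s in Icc 0 1, (1 - cdf H s) * Q s := by
  have h1 := (hH.integrable_iff _).1 hxQ
  have h2 := integrableOn_one_sub_cdf_mul H hQ
  have h3 : (fun x => h x * (x * Q x) - (1 - cdf H x) * Q x) =ᵐ[volume.restrict (Icc 0 1)]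
      fun x => h x * (virtualReal H h x * Q x) := by
    rw [← restrict_Ioo_eq_restrict_Icc]
    refine (ae_restrict_iff' measurableSet_Ioo).2 (.of_forall fun x hx => ?_)
    have := (hH.density_pos hx).ne'
    simp only [virtualReal]
    field_simp
  constructor
  · rw [hH.integrable_iff]
    exact (h1.sub h2).congr h3
  · rw [hH.integral_eq, hH.integral_eq (fun x => x * Q x), ← integral_congr_ae h3,
      integral_sub h1 h2]

/-- The expected payment in an incentive compatible mechanism is the expected virtual surplus, up to
the payment of the lowest type. -/
lemma integral_payment (hH : IsTypeLaw H h) {Q T : ℝ → ℝ} (hQ : IncentiveCompatible Q T) :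
    Integrable T H ∧ ∫ x, T x ∂H = ∫ x, virtualReal H h x * Q x ∂H + T 0 := by
  have := hH.isProb
  have hxQ : Integrable (fun x => x * Q x) H := by
    refine hH.integrable_of_bdd (c := 1)
      (measurable_id.aestronglyMeasurable.mul hQ.integrableOn.aestronglyMeasurable) fun x hx => ?_
    have h1 := hQ.mem_Icc x hx
    rw [abs_of_nonneg (mul_nonneg hx.1 h1.1)]
    exact mul_le_one₀ hx.2 h1.1 h1.2
  obtain ⟨i1, e1⟩ := hH.integral_integral_eq hQ.integrableOn
  have hT : (fun x => x * Q x - (∫ s in (0 : ℝ)..x, Q s) + T 0) =ᵐ[H] T := by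
    filter_upwards [hH.ae_mem_Icc] with x hx
    have := hQ.envelope hx
    linarith
  refine ⟨((hxQ.sub i1).add (integrable_const _)).congr hT, ?_⟩
  rw [← integral_congr_ae hT, integral_add (f := fun x => x * Q x - ∫ s in (0 : ℝ)..x, Q s)
    (hxQ.sub i1) (integrable_const _), integral_sub hxQ i1, e1, (hH.integrable_virtualReal_mul hQ.integrableOn hxQ).2]
  simp

lemma integrable_virtualReal (hH : IsTypeLaw H h) : Integrable (virtualReal H h) H := by
  have := (hH.integrable_virtualReal_mul (Q := fun _ => 1) (by simp)
    (hH.integrable_of_monotoneOn fun x _ y _ hxy => by simpa using hxy)).1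
  simpa using this

/-- A posted price `p` is an incentive compatible mechanism with revenue `p (1 - cdf H p)`. -/
lemma integral_virtualReal_Ici (hH : IsTypeLaw H h) {p : ℝ} (hp : p ∈ Icc (0 : ℝ) 1) :
    ∫ x in Ici p, virtualReal H h x ∂H = p * (1 - cdf H p) := by
  have := hH.isProb
  have := hH.nullSingletonClass
  have hT : IncentiveCompatible ((Ici p).indicator fun _ => 1) ((Ici p).indicator fun _ => p) := by
    constructor
    · intro x _
      by_cases hx : p ≤ x <;> simp [hx]
    · intro x _ y _
      by_cases hx : p ≤ x <;> by_cases hy : p ≤ y <;> simp [hx, hy]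
      all_goals linarith
  have e := (hH.integral_payment hT).2
  -- If `p = 0` the lowest type does buy, but at price zero.
  have e0 : (Ici p).indicator (fun _ => p) 0 = 0 := by
    by_cases h0 : p ≤ 0
    · simp [le_antisymm h0 hp.1]
    · simp [h0]
  rw [e0, add_zero, integral_indicator measurableSet_Ici, setIntegral_const, smul_eq_mul,
    ← measureReal_congr Ioi_ae_eq_Ici, ← compl_Iic, probReal_compl_eq_one_sub measurableSet_Iic,
    ← cdf_eq_real] at e
  rw [mul_comm, e, ← integral_indicator measurableSet_Ici]
  congr 1
  ext x
  by_cases hx : p ≤ x <;> simp [hx]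

/-- Giving the good away for free earns nothing. This mean-zero property is what makes always
allocating harmless. -/
lemma integral_virtualReal (hH : IsTypeLaw H h) : ∫ x, virtualReal H h x ∂H = 0 := by
  have := hH.integral_virtualReal_Ici (p := 0) (by simp)
  rw [zero_mul, Measure.restrict_eq_self_of_ae_mem] at this
  · exact this
  · filter_upwards [hH.ae_mem_Icc] with x hx using hx.1

/-- The positive part of the virtual value integrates to the revenue of a posted price. -/
lemma exists_integral_virtualReal_max (hH : IsTypeLaw H h) :
    ∃ p ∈ Icc (0 : ℝ) 1, ∫ x, max (virtualReal H h x) 0 ∂H = p * (1 - cdf H p) := by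
  have := hH.nullSingletonClass
  have h01 : (0 : EReal) ≤ 1 := zero_le_one
  refine ⟨virtualInv H h 0, hH.virtualInv_mem h01, ?_⟩
  rw [← hH.integral_virtualReal_Ici (hH.virtualInv_mem h01), ← integral_indicator measurableSet_Ici]
  refine integral_congr_ae ?_
  filter_upwards [hH.ae_mem_Ioo, Measure.ae_ne H (virtualInv H h 0)] with x hx hne
  have hx' := Ioo_subset_Icc_self hx
  rcases lt_or_gt_of_ne hne with hlt | hlt
  · have h1 := lt_of_lt_virtualInv hx' hlt
    rw [hH.virtualValue_eq hx] at h1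
    have h2 : virtualReal H h x < 0 := by exact_mod_cast h1
    simp [hlt, max_eq_right h2.le]
  · have h1 := hH.le_of_virtualInv_lt hx' h01 hlt
    rw [hH.virtualValue_eq hx] at h1
    have h2 : 0 ≤ virtualReal H h x := by exact_mod_cast h1
    simp [hlt.le, max_eq_left h2]

end IsTypeLaw

/-! ### Integration against mixtures; bounded allocations -/

lemma integrable_integral_bind {α β : Type*} [MeasurableSpace α] [MeasurableSpace β]
    {μ : Measure α} {k : α → Measure β} (hk : Measurable k) {φ : β → ℝ}
    (hφ : Integrable φ (μ.bind k)) :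
    Integrable (fun a => ∫ b, φ b ∂(k a)) μ ∧ ∫ b, φ b ∂(μ.bind k) = ∫ a, ∫ b, φ b ∂(k a) ∂μ := by
  have e : μ.bind k = ((⟨k, hk⟩ : Kernel α β) ∘ₖ Kernel.const Unit μ) () := by
    rw [Kernel.comp_apply, Kernel.const_apply]; rfl
  rw [e] at hφ ⊢
  have h1 := hφ.integral_comp
  have h2 := Kernel.integral_comp hφ
  rw [Kernel.const_apply] at h1 h2
  exact ⟨h1, h2⟩

lemma measurable_q₁ : Measurable q₁ := by unfold q₁; fun_prop
lemma measurable_q₂ : Measurable q₂ := by unfold q₂; fun_prop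
lemma measurable_t₁ : Measurable t₁ := by unfold t₁; fun_prop
lemma measurable_t₂ : Measurable t₂ := by unfold t₂; fun_prop

lemma q₁_nonneg (x : Outcome) : 0 ≤ q₁ x := x.2.1
lemma q₂_nonneg (x : Outcome) : 0 ≤ q₂ x := x.2.2.1
lemma q₁_add_q₂_le (x : Outcome) : q₁ x + q₂ x ≤ 1 := x.2.2.2
lemma q₁_le_one (x : Outcome) : q₁ x ≤ 1 := by
  linarith [q₂_nonneg x, q₁_add_q₂_le x]
lemma q₂_le_one (x : Outcome) : q₂ x ≤ 1 := by
  linarith [q₁_nonneg x, q₁_add_q₂_le x]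

section Bounded

variable {α : Type*} [MeasurableSpace α] {μ : Measure α}

lemma integrable_of_mem_Icc [IsFiniteMeasure μ] {φ : α → ℝ} (hm : AEStronglyMeasurable φ μ)
    (h : ∀ᵐ a ∂μ, φ a ∈ Icc (0 : ℝ) 1) : Integrable φ μ := by
  refine Integrable.of_bound hm 1 ?_
  filter_upwards [h] with a ha
  rw [Real.norm_eq_abs, abs_of_nonneg ha.1]
  exact ha.2

lemma integral_mem_Icc [IsProbabilityMeasure μ] {φ : α → ℝ} (hm : AEStronglyMeasurable φ μ)
    (h : ∀ᵐ a ∂μ, φ a ∈ Icc (0 : ℝ) 1) : ∫ a, φ a ∂μ ∈ Icc (0 : ℝ) 1 := by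
  refine ⟨integral_nonneg_of_ae (h.mono fun a ha => ha.1), ?_⟩
  have := integral_mono_ae (integrable_of_mem_Icc hm h) (integrable_const 1)
    (h.mono fun a ha => ha.2)
  simpa using this

lemma integrable_q₁ (μ : Measure Outcome) [IsFiniteMeasure μ] : Integrable q₁ μ :=
  integrable_of_mem_Icc measurable_q₁.aestronglyMeasurable
    (.of_forall fun x => ⟨q₁_nonneg x, q₁_le_one x⟩)

lemma integrable_q₂ (μ : Measure Outcome) [IsFiniteMeasure μ] : Integrable q₂ μ :=
  integrable_of_mem_Icc measurable_q₂.aestronglyMeasurable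
    (.of_forall fun x => ⟨q₂_nonneg x, q₂_le_one x⟩)

lemma integral_q₁_mem (μ : Measure Outcome) [IsProbabilityMeasure μ] :
    ∫ x, q₁ x ∂μ ∈ Icc (0 : ℝ) 1 :=
  integral_mem_Icc measurable_q₁.aestronglyMeasurable
    (.of_forall fun x => ⟨q₁_nonneg x, q₁_le_one x⟩)

lemma integral_q₂_mem (μ : Measure Outcome) [IsProbabilityMeasure μ] :
    ∫ x, q₂ x ∂μ ∈ Icc (0 : ℝ) 1 :=
  integral_mem_Icc measurable_q₂.aestronglyMeasurable
    (.of_forall fun x => ⟨q₂_nonneg x, q₂_le_one x⟩)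

lemma integral_u₁ {μ : Measure Outcome} [IsFiniteMeasure μ] (h : Integrable t₁ μ) (θ : ℝ) :
    ∫ x, u₁ x θ ∂μ = θ * ∫ x, q₁ x ∂μ - ∫ x, t₁ x ∂μ := by
  simp only [u₁]
  rw [integral_sub ((integrable_q₁ μ).const_mul θ) h, integral_const_mul]

lemma integral_u₂ {μ : Measure Outcome} [IsFiniteMeasure μ] (h : Integrable t₂ μ) (θ : ℝ) :
    ∫ x, u₂ x θ ∂μ = θ * ∫ x, q₂ x ∂μ - ∫ x, t₂ x ∂μ := by
  simp only [u₂]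
  rw [integral_sub ((integrable_q₂ μ).const_mul θ) h, integral_const_mul]

end Bounded

/-! ### Equilibria as pairs of incentive compatible mechanisms -/

namespace Profile

variable {Λ : Type} [MeasurableSpace Λ] (e : Profile Λ) (F G : Measure ℝ)

instance : IsMarkovKernel e.choice := e.choice_markov
instance : IsMarkovKernel e.response := e.response_markov
instance : IsMarkovKernel e.belief := e.belief_markov

/-- The intermediary's expected allocation given the menu and the consumer's type. -/
noncomputable def alloc₁ (m : Λ ⊕ Unit) (θ₂ : ℝ) : ℝ := ∫ x, q₁ x ∂(e.response (m, θ₂))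

/-- The consumer's expected allocation given the menu and his type. -/
noncomputable def alloc₂ (m : Λ ⊕ Unit) (θ₂ : ℝ) : ℝ := ∫ x, q₂ x ∂(e.response (m, θ₂))

/-- The consumer's expected payment given the menu and his type. -/
noncomputable def pay₂ (m : Λ ⊕ Unit) (θ₂ : ℝ) : ℝ := ∫ x, t₂ x ∂(e.response (m, θ₂))

/-- The intermediary's expected allocation when offering a menu. -/
noncomputable def menuAlloc (m : Λ ⊕ Unit) : ℝ := ∫ x, q₁ x ∂(e.menuLaw F m)

/-- The intermediary's expected payment when offering a menu. -/
noncomputable def menuPay (m : Λ ⊕ Unit) : ℝ := ∫ x, t₁ x ∂(e.menuLaw F m)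

lemma alloc₁_mem (m : Λ ⊕ Unit) (θ₂ : ℝ) : e.alloc₁ m θ₂ ∈ Icc (0 : ℝ) 1 := integral_q₁_mem _
lemma alloc₂_mem (m : Λ ⊕ Unit) (θ₂ : ℝ) : e.alloc₂ m θ₂ ∈ Icc (0 : ℝ) 1 := integral_q₂_mem _

lemma stronglyMeasurable_alloc₁ :
    StronglyMeasurable fun p : (Λ ⊕ Unit) × ℝ => e.alloc₁ p.1 p.2 :=
  measurable_q₁.stronglyMeasurable.integral_kernel

lemma stronglyMeasurable_alloc₂ :
    StronglyMeasurable fun p : (Λ ⊕ Unit) × ℝ => e.alloc₂ p.1 p.2 :=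
  measurable_q₂.stronglyMeasurable.integral_kernel

lemma measurable_response_left (m : Λ ⊕ Unit) : Measurable fun θ₂ => e.response (m, θ₂) :=
  e.response.measurable.comp measurable_prodMk_left

lemma measurable_response_right (θ₂ : ℝ) : Measurable fun m => e.response (m, θ₂) :=
  e.response.measurable.comp measurable_prodMk_right

instance [IsProbabilityMeasure F] (m : Λ ⊕ Unit) : IsProbabilityMeasure (e.menuLaw F m) :=
  isProbabilityMeasure_bind (e.measurable_response_left m).aemeasurable
    (.of_forall fun _ => inferInstance)

instance (θ₁ θ₂ : ℝ) : IsProbabilityMeasure (e.outcome θ₁ θ₂) :=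
  isProbabilityMeasure_bind (e.measurable_response_right θ₂).aemeasurable
    (.of_forall fun _ => inferInstance)

instance [IsProbabilityMeasure G] : IsProbabilityMeasure (G.bind e.choice) :=
  isProbabilityMeasure_bind e.choice.measurable.aemeasurable (.of_forall fun _ => inferInstance)

instance [IsProbabilityMeasure F] [IsProbabilityMeasure G] :
    IsProbabilityMeasure (e.outcomeLaw F G) :=
  isProbabilityMeasure_bind e.response.measurable.aemeasurable (.of_forall fun _ => inferInstance)

lemma menuAlloc_eq [IsProbabilityMeasure F] (m : Λ ⊕ Unit) :
    e.menuAlloc F m = ∫ θ₂, e.alloc₁ m θ₂ ∂F :=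
  (integrable_integral_bind (e.measurable_response_left m)
    (integrable_q₁ (e.menuLaw F m))).2

lemma menuAlloc_mem [IsProbabilityMeasure F] (m : Λ ⊕ Unit) :
    e.menuAlloc F m ∈ Icc (0 : ℝ) 1 := integral_q₁_mem _

lemma stronglyMeasurable_menuAlloc [IsProbabilityMeasure F] :
    StronglyMeasurable (e.menuAlloc F) := by
  simp only [funext (e.menuAlloc_eq F)]
  exact e.stronglyMeasurable_alloc₁.integral_prod_right

lemma integrable_menuAlloc [IsProbabilityMeasure F] (μ : Measure (Λ ⊕ Unit)) [IsFiniteMeasure μ] :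
    Integrable (e.menuAlloc F) μ :=
  integrable_of_mem_Icc (e.stronglyMeasurable_menuAlloc F).aestronglyMeasurable
    (.of_forall (e.menuAlloc_mem F))

/-- The intermediary's expected allocation given both types. -/
noncomputable def expAlloc₁ (θ₁ θ₂ : ℝ) : ℝ := ∫ x, q₁ x ∂(e.outcome θ₁ θ₂)

/-- The consumer's expected allocation given both types. -/
noncomputable def expAlloc₂ (θ₁ θ₂ : ℝ) : ℝ := ∫ x, q₂ x ∂(e.outcome θ₁ θ₂)

lemma expAlloc₁_eq (θ₁ θ₂ : ℝ) : e.expAlloc₁ θ₁ θ₂ = ∫ m, e.alloc₁ m θ₂ ∂(e.choice θ₁) :=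
  (integrable_integral_bind (e.measurable_response_right θ₂)
    (integrable_q₁ (e.outcome θ₁ θ₂))).2

lemma expAlloc₂_eq (θ₁ θ₂ : ℝ) : e.expAlloc₂ θ₁ θ₂ = ∫ m, e.alloc₂ m θ₂ ∂(e.choice θ₁) :=
  (integrable_integral_bind (e.measurable_response_right θ₂)
    (integrable_q₂ (e.outcome θ₁ θ₂))).2

lemma expAlloc₁_mem (θ₁ θ₂ : ℝ) : e.expAlloc₁ θ₁ θ₂ ∈ Icc (0 : ℝ) 1 := integral_q₁_mem _
lemma expAlloc₂_mem (θ₁ θ₂ : ℝ) : e.expAlloc₂ θ₁ θ₂ ∈ Icc (0 : ℝ) 1 := integral_q₂_mem _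

lemma expAlloc_add (θ₁ θ₂ : ℝ) :
    e.expAlloc₁ θ₁ θ₂ + e.expAlloc₂ θ₁ θ₂ = ∫ x, (q₁ x + q₂ x) ∂(e.outcome θ₁ θ₂) :=
  (integral_add (integrable_q₁ _) (integrable_q₂ _)).symm

lemma expAlloc_add_mem (θ₁ θ₂ : ℝ) :
    e.expAlloc₁ θ₁ θ₂ + e.expAlloc₂ θ₁ θ₂ ∈ Icc (0 : ℝ) 1 := by
  rw [expAlloc_add]
  exact integral_mem_Icc (measurable_q₁.add measurable_q₂).aestronglyMeasurable
    (.of_forall fun x => ⟨add_nonneg (q₁_nonneg x) (q₂_nonneg x), q₁_add_q₂_le x⟩)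

lemma stronglyMeasurable_expAlloc₁ (θ₁ : ℝ) : StronglyMeasurable (e.expAlloc₁ θ₁) := by
  simp only [funext (e.expAlloc₁_eq θ₁)]
  exact StronglyMeasurable.integral_prod_left (f := e.alloc₁) e.stronglyMeasurable_alloc₁

lemma stronglyMeasurable_expAlloc₂ (θ₁ : ℝ) : StronglyMeasurable (e.expAlloc₂ θ₁) := by
  simp only [funext (e.expAlloc₂_eq θ₁)]
  exact StronglyMeasurable.integral_prod_left (f := e.alloc₂) e.stronglyMeasurable_alloc₂

/-- The intermediary's expected payment given his type. -/
noncomputable def expPay₁ (θ₁ : ℝ) : ℝ := ∫ m, e.menuPay F m ∂(e.choice θ₁)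

namespace IsEquilibrium

variable {e F G} {C : Λ → Set Outcome} {f g : ℝ → ℝ}

/-- Values are private, so the consumer's belief integrates out. -/
lemma agentPayoff_eq (he : e.IsEquilibrium F G C) (m : Λ ⊕ Unit) {θ : ℝ}
    (hθ : θ ∈ Icc (0 : ℝ) 1) : e.agentPayoff m θ = θ * e.alloc₂ m θ - e.pay₂ m θ := by
  simp only [agentPayoff, integral_u₂ (he.agent_integrable m θ hθ)]
  simp [alloc₂, pay₂]

/-- Mimicking type `y` means receiving a lottery over outcomes of the same menu, each of which is no
better for type `x` than his equilibrium payoff. -/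
lemma incentiveCompatible₂ (he : e.IsEquilibrium F G C) (m : Λ ⊕ Unit) :
    IncentiveCompatible (e.alloc₂ m) (e.pay₂ m) := by
  refine ⟨fun x _ => e.alloc₂_mem m x, fun x hx y hy => ?_⟩
  have hint := he.agent_integrable m y hy
  have e1 := integral_u₂ hint x
  rw [← he.agentPayoff_eq m hx]
  have h2 : ∫ z, u₂ z x ∂(e.response (m, y)) ≤ ∫ z, e.agentPayoff m x ∂(e.response (m, y)) := by
    refine integral_mono_ae (((integrable_q₂ _).const_mul x).sub hint) (integrable_const _) ?_
    filter_upwards [he.response_mem m y hy] with z hz using he.agent_optimal m x hx z hz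
  simp only [integral_const, probReal_univ, one_smul] at h2
  exact e1.symm.trans_le h2

lemma pay₂_zero_nonpos (he : e.IsEquilibrium F G C) (m : Λ ⊕ Unit) : e.pay₂ m 0 ≤ 0 := by
  have h0 : (0 : ℝ) ∈ Icc (0 : ℝ) 1 := by simp
  have h1 := he.agent_optimal m 0 h0 noTrade (mem_insert _ _)
  rw [he.agentPayoff_eq m h0] at h1
  simp [u₂, noTrade, q₂, t₂] at h1
  exact h1

lemma delegatePayoff_eq [IsProbabilityMeasure F] (he : e.IsEquilibrium F G C) (m : Λ ⊕ Unit)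
    (θ : ℝ) : e.delegatePayoff F θ m = θ * e.menuAlloc F m - e.menuPay F m :=
  integral_u₁ (he.delegate_integrable m) θ

lemma integrable_menuPay [IsProbabilityMeasure F] (he : e.IsEquilibrium F G C) {θ : ℝ}
    (hθ : θ ∈ Icc (0 : ℝ) 1) : Integrable (e.menuPay F) (e.choice θ) := by
  refine (((e.integrable_menuAlloc F (e.choice θ)).const_mul θ).sub
    (he.delegate_integrable' θ hθ)).congr (.of_forall fun m => ?_)
  have := he.delegatePayoff_eq m θ
  simp only [Pi.sub_apply]
  linarith

lemma integral_delegatePayoff [IsProbabilityMeasure F] (he : e.IsEquilibrium F G C) {θ : ℝ}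
    (hθ : θ ∈ Icc (0 : ℝ) 1) (x : ℝ) : ∫ m, e.delegatePayoff F x m ∂(e.choice θ) =
      x * ∫ m, e.menuAlloc F m ∂(e.choice θ) - e.expPay₁ F θ := by
  simp only [he.delegatePayoff_eq]
  rw [integral_sub ((e.integrable_menuAlloc F _).const_mul _) (he.integrable_menuPay hθ),
    integral_const_mul, expPay₁]

/-- Optimality against each single menu is averaged over the lottery chosen by the imitated type. -/
lemma incentiveCompatible₁ [IsProbabilityMeasure F] (he : e.IsEquilibrium F G C) :
    IncentiveCompatible (fun θ => ∫ m, e.menuAlloc F m ∂(e.choice θ)) (e.expPay₁ F) := by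
  refine ⟨fun x _ => integral_mem_Icc (e.stronglyMeasurable_menuAlloc F).aestronglyMeasurable
    (.of_forall (e.menuAlloc_mem F)), fun x hx y hy => ?_⟩
  rw [← he.integral_delegatePayoff hx, ← he.integral_delegatePayoff hy]
  have h2 := integral_mono (μ := e.choice y) (f := e.delegatePayoff F x)
    (g := fun _ => ∫ m, e.delegatePayoff F x m ∂(e.choice x)) ?_ (integrable_const _)
    (he.delegate_optimal x hx)
  · simpa using h2
  · simp only [funext fun m => he.delegatePayoff_eq m x]
    exact ((e.integrable_menuAlloc F _).const_mul _).sub (he.integrable_menuPay hy)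

/-- Opting out leaves only `noTrade`, so it is worth zero, while type `0` gets minus his expected
payment. -/
lemma expPay₁_zero_nonpos (hF : IsTypeLaw F f) (he : e.IsEquilibrium F G C) :
    e.expPay₁ F 0 ≤ 0 := by
  have := hF.isProb
  have h0 : (0 : ℝ) ∈ Icc (0 : ℝ) 1 := by simp
  have h1 := he.delegate_optimal 0 h0 (Sum.inr ())
  rw [he.integral_delegatePayoff h0] at h1
  have h2 : e.delegatePayoff F 0 (Sum.inr ()) = 0 := by
    rw [delegatePayoff, menuLaw, (integrable_integral_bind (e.measurable_response_left _) _).2]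
    · refine integral_eq_zero_of_ae ?_
      filter_upwards [hF.ae_mem_Icc] with θ hθ
      refine integral_eq_zero_of_ae ?_
      filter_upwards [he.response_mem (Sum.inr ()) θ hθ] with x hx
      have : x = noTrade := by simpa [fullMenu] using hx
      simp [this, u₁, noTrade, q₁, t₁]
    · exact ((integrable_q₁ (e.menuLaw F _)).const_mul _).sub (he.delegate_integrable _)
  rw [h2] at h1
  linarith

/-- Revenue is expected virtual surplus, up to the payments of the lowest types. -/
lemma revenue_eq (hF : IsTypeLaw F f) (hG : IsTypeLaw G g) (he : e.IsEquilibrium F G C)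
    (hfin : e.FiniteTransfers F G) :
    Integrable (fun θ₁ => ∫ θ₂, (virtualReal G g θ₁ * e.expAlloc₁ θ₁ θ₂ +
      virtualReal F f θ₂ * e.expAlloc₂ θ₁ θ₂) ∂F) G ∧
    e.revenue F G = ∫ θ₁, ∫ θ₂, (virtualReal G g θ₁ * e.expAlloc₁ θ₁ θ₂ +
      virtualReal F f θ₂ * e.expAlloc₂ θ₁ θ₂) ∂F ∂G + e.expPay₁ F 0 +
      ∫ m, e.pay₂ m 0 ∂(G.bind e.choice) := by
  have := hF.isProb
  have := hG.isProb
  have hb := hF.integrable_virtualReal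
  obtain ⟨i1, e1⟩ := integrable_integral_bind e.response.measurable hfin.1
  obtain ⟨i2, e2⟩ := integrable_integral_bind e.response.measurable hfin.2
  have hS : Integrable (fun p : (Λ ⊕ Unit) × ℝ => virtualReal F f p.2 * e.alloc₂ p.1 p.2)
      ((G.bind e.choice).prod F) := by
    have hb' : Integrable (fun p : (Λ ⊕ Unit) × ℝ => virtualReal F f p.2)
      ((G.bind e.choice).prod F) := hb.comp_snd _
    refine hb'.mul_bdd (c := 1) e.stronglyMeasurable_alloc₂.aestronglyMeasurable
      (.of_forall fun p => ?_)
    have := e.alloc₂_mem p.1 p.2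
    rw [Real.norm_eq_abs, abs_of_nonneg this.1]
    exact this.2
  -- the intermediary's payments
  have hp1 : ∀ᵐ m ∂(G.bind e.choice), (∫ θ₂, ∫ x, t₁ x ∂(e.response (m, θ₂)) ∂F) = e.menuPay F m :=
    .of_forall fun m => (integrable_integral_bind (e.measurable_response_left m)
      (he.delegate_integrable m)).2.symm
  rw [integral_prod _ i1, integral_congr_ae hp1] at e1
  have i1' := i1.integral_prod_left.congr hp1
  obtain ⟨-, e1'⟩ := integrable_integral_bind e.choice.measurable i1'
  obtain ⟨-, e1''⟩ := hG.integral_payment he.incentiveCompatible₁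
  have e1f : ∫ x, t₁ x ∂(e.outcomeLaw F G) = ∫ θ₁, virtualReal G g θ₁ *
      (∫ m, e.menuAlloc F m ∂(e.choice θ₁)) ∂G + e.expPay₁ F 0 := e1.trans (e1'.trans e1'')
  have ia : Integrable (fun θ₁ => virtualReal G g θ₁ *
      (∫ m, e.menuAlloc F m ∂(e.choice θ₁))) G := by
    refine hG.integrable_virtualReal.mul_bdd (c := 1)
      (e.stronglyMeasurable_menuAlloc F).integral_kernel.aestronglyMeasurable
      (.of_forall fun θ => ?_)
    have := integral_mem_Icc (μ := e.choice θ)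
      (e.stronglyMeasurable_menuAlloc F).aestronglyMeasurable (.of_forall (e.menuAlloc_mem F))
    rw [Real.norm_eq_abs, abs_of_nonneg this.1]
    exact this.2
  -- the consumer's payments
  have hp2 : (fun m => ∫ θ₂, ∫ x, t₂ x ∂(e.response (m, θ₂)) ∂F) =
      fun m => ∫ θ₂, virtualReal F f θ₂ * e.alloc₂ m θ₂ ∂F + e.pay₂ m 0 :=
    funext fun m => (hF.integral_payment (he.incentiveCompatible₂ m)).2
  have i2' := i2.integral_prod_left
  rw [integral_prod _ i2, hp2] at e2
  rw [hp2] at i2'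
  have i3 := hS.integral_prod_left
  -- No bound on the lowest type's payment is available a priori; its integrability comes from
  -- finite transfers and the integrable virtual surplus.
  have i4 : Integrable (fun m => e.pay₂ m 0) (G.bind e.choice) :=
    (i2'.sub i3).congr (.of_forall fun m => by simp)
  rw [integral_add i3 i4] at e2
  obtain ⟨i3', e3⟩ := integrable_integral_bind e.choice.measurable i3
  rw [e3] at e2
  -- rearrangement
  have swap : ∀ θ₁, ∫ θ₂, (virtualReal G g θ₁ * e.expAlloc₁ θ₁ θ₂ +
      virtualReal F f θ₂ * e.expAlloc₂ θ₁ θ₂) ∂F =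
      virtualReal G g θ₁ * (∫ m, e.menuAlloc F m ∂(e.choice θ₁)) +
        ∫ m, ∫ θ₂, virtualReal F f θ₂ * e.alloc₂ m θ₂ ∂F ∂(e.choice θ₁) := by
    intro θ₁
    have j1 : Integrable (e.expAlloc₁ θ₁) F := integrable_of_mem_Icc
      (e.stronglyMeasurable_expAlloc₁ θ₁).aestronglyMeasurable (.of_forall (e.expAlloc₁_mem θ₁))
    have j2 : Integrable (fun θ₂ => virtualReal F f θ₂ * e.expAlloc₂ θ₁ θ₂) F := by
      refine hb.mul_bdd (c := 1) (e.stronglyMeasurable_expAlloc₂ θ₁).aestronglyMeasurable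
        (.of_forall fun θ => ?_)
      have := e.expAlloc₂_mem θ₁ θ
      rw [Real.norm_eq_abs, abs_of_nonneg this.1]
      exact this.2
    have k1 : Integrable (Function.uncurry e.alloc₁) ((e.choice θ₁).prod F) :=
      integrable_of_mem_Icc e.stronglyMeasurable_alloc₁.aestronglyMeasurable
        (.of_forall fun p => e.alloc₁_mem p.1 p.2)
    have k2 : Integrable (Function.uncurry fun m θ₂ => virtualReal F f θ₂ * e.alloc₂ m θ₂)
        ((e.choice θ₁).prod F) := by
      have hb' : Integrable (fun p : (Λ ⊕ Unit) × ℝ => virtualReal F f p.2)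
        ((e.choice θ₁).prod F) := hb.comp_snd _
      refine hb'.mul_bdd (c := 1) e.stronglyMeasurable_alloc₂.aestronglyMeasurable
        (.of_forall fun p => ?_)
      have := e.alloc₂_mem p.1 p.2
      rw [Real.norm_eq_abs, abs_of_nonneg this.1]
      exact this.2
    rw [integral_add (j1.const_mul _) j2, integral_const_mul, integral_integral_swap k2]
    simp only [menuAlloc_eq, integral_integral_swap k1, expAlloc₁_eq, expAlloc₂_eq,
      integral_const_mul]
  constructor
  · simp only [swap]
    exact ia.add i3'
  · simp only [swap]
    rw [integral_add ia i3', revenue, integral_add hfin.1 hfin.2, e1f]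
    have e2' : ∫ x, t₂ x ∂(e.outcomeLaw F G) = _ := e2
    rw [e2']
    ring

end IsEquilibrium

end Profile

/-! ### Upper bounds on revenue -/

/-- The expected surplus when the good goes to whoever has the larger virtual value. -/
noncomputable def maxSurplus (F G : Measure ℝ) (f g : ℝ → ℝ) : ℝ :=
  ∫ θ₁, ∫ θ₂, max (virtualReal G g θ₁) (virtualReal F f θ₂) ∂F ∂G

section Surplus

variable {F G : Measure ℝ} {f g : ℝ → ℝ}

lemma integrable_max_const (hF : IsTypeLaw F f) (c : ℝ) :
    Integrable (fun θ₂ => max c (virtualReal F f θ₂)) F := by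
  have := hF.isProb
  exact (integrable_const c).sup hF.integrable_virtualReal

lemma integrable_integral_max (hF : IsTypeLaw F f) (hG : IsTypeLaw G g) :
    Integrable (fun θ₁ => ∫ θ₂, max (virtualReal G g θ₁) (virtualReal F f θ₂) ∂F) G := by
  have := hF.isProb
  have := hG.isProb
  have h1 : Integrable (fun p : ℝ × ℝ => virtualReal G g p.1) (G.prod F) :=
    hG.integrable_virtualReal.comp_fst _
  have h2 : Integrable (fun p : ℝ × ℝ => virtualReal F f p.2) (G.prod F) :=
    hF.integrable_virtualReal.comp_snd _
  exact (h1.sup h2).integral_prod_left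

/-- Selling to the consumer at price `p`, with the intermediary as residual buyer, does not exceed
the maximal surplus. -/
lemma price_revenue_le_maxSurplus (hF : IsTypeLaw F f) (hG : IsTypeLaw G g) {p : ℝ}
    (hp : p ∈ Icc (0 : ℝ) 1) : p * (1 - cdf F p) ≤ maxSurplus F G f g := by
  have := hF.isProb
  have := hG.isProb
  have hb := hF.integrable_virtualReal
  -- The maximum is bounded below by `ψ_F` on `[p, ∞)` and by `ψ_G(θ₁)` elsewhere; the second part
  -- averages to zero over `θ₁`.
  have key : ∀ θ₁, p * (1 - cdf F p) + virtualReal G g θ₁ * F.real (Ici p)ᶜ ≤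
      ∫ θ₂, max (virtualReal G g θ₁) (virtualReal F f θ₂) ∂F := by
    intro θ₁
    have hi := integrable_max_const hF (virtualReal G g θ₁)
    rw [← integral_add_compl measurableSet_Ici hi, ← hF.integral_virtualReal_Ici hp]
    refine add_le_add ?_ ?_
    · exact integral_mono hb.integrableOn hi.integrableOn fun x => le_max_right _ _
    · have := integral_mono (μ := F.restrict (Ici p)ᶜ) (f := fun _ => virtualReal G g θ₁)
        (integrable_const _) hi.integrableOn fun x => le_max_left _ _
      simpa [mul_comm] using this
  have h2 := integral_mono (μ := G) ((integrable_const _).add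
    (hG.integrable_virtualReal.mul_const _)) (integrable_integral_max hF hG) key
  rw [integral_add' (integrable_const _) (hG.integrable_virtualReal.mul_const _),
    integral_mul_const (F.real (Ici p)ᶜ), hG.integral_virtualReal] at h2
  simpa [maxSurplus] using h2

/-- Both integrals are posted-price revenues. By gains from trade, the price `r` meant for the
intermediary earns at least as much when charged to the consumer. -/
lemma integral_max_le_two_mul_maxSurplus (hF : IsTypeLaw F f) (hG : IsTypeLaw G g)
    (hFG : GainsFromTrade F G) :
    ∫ θ₁, max (virtualReal G g θ₁) 0 ∂G + ∫ θ₂, max (virtualReal F f θ₂) 0 ∂F ≤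
      2 * maxSurplus F G f g := by
  obtain ⟨p, hp, ep⟩ := hF.exists_integral_virtualReal_max
  obtain ⟨r, hr, er⟩ := hG.exists_integral_virtualReal_max
  have h1 := price_revenue_le_maxSurplus hF hG hp
  have h2 := price_revenue_le_maxSurplus hF hG hr
  have h3 : r * (1 - cdf G r) ≤ r * (1 - cdf F r) :=
    mul_le_mul_of_nonneg_left (by linarith [hFG.cdf_le_cdf hF hG hr.1]) hr.1
  rw [ep, er]
  linarith

variable {Λ : Type} [MeasurableSpace Λ] {e : Profile Λ} {C : Λ → Set Outcome}

lemma Profile.integrable_surplus (e : Profile Λ) (hF : IsTypeLaw F f) (θ₁ c : ℝ) :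
    Integrable (fun θ₂ => c * e.expAlloc₁ θ₁ θ₂ + virtualReal F f θ₂ * e.expAlloc₂ θ₁ θ₂) F := by
  have := hF.isProb
  refine Integrable.add (Integrable.const_mul (integrable_of_mem_Icc
    (e.stronglyMeasurable_expAlloc₁ θ₁).aestronglyMeasurable
    (.of_forall (e.expAlloc₁_mem θ₁))) _) ?_
  refine hF.integrable_virtualReal.mul_bdd (c := 1)
    (e.stronglyMeasurable_expAlloc₂ θ₁).aestronglyMeasurable (.of_forall fun θ => ?_)
  have := e.expAlloc₂_mem θ₁ θ
  rw [Real.norm_eq_abs, abs_of_nonneg this.1]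
  exact this.2

namespace Profile.IsEquilibrium

lemma revenue_le_surplus (hF : IsTypeLaw F f) (hG : IsTypeLaw G g) (he : e.IsEquilibrium F G C)
    (hfin : e.FiniteTransfers F G) :
    e.revenue F G ≤ ∫ θ₁, ∫ θ₂, (virtualReal G g θ₁ * e.expAlloc₁ θ₁ θ₂ +
      virtualReal F f θ₂ * e.expAlloc₂ θ₁ θ₂) ∂F ∂G := by
  have h1 := he.expPay₁_zero_nonpos hF
  have h2 : ∫ m, e.pay₂ m 0 ∂(G.bind e.choice) ≤ 0 := integral_nonpos he.pay₂_zero_nonpos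
  rw [(he.revenue_eq hF hG hfin).2]
  linarith

/-- An upper bound on revenue when buybacks are possible. -/
lemma revenue_le_integral_max (hF : IsTypeLaw F f) (hG : IsTypeLaw G g)
    (he : e.IsEquilibrium F G C) (hfin : e.FiniteTransfers F G) :
    e.revenue F G ≤
      ∫ θ₁, max (virtualReal G g θ₁) 0 ∂G + ∫ θ₂, max (virtualReal F f θ₂) 0 ∂F := by
  have := hF.isProb
  have := hG.isProb
  have ia : Integrable (fun θ₁ => max (virtualReal G g θ₁) 0) G :=
    hG.integrable_virtualReal.sup (integrable_const 0)
  have ib : Integrable (fun θ₂ => max (virtualReal F f θ₂) 0) F :=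
    hF.integrable_virtualReal.sup (integrable_const 0)
  have h := integral_mono (he.revenue_eq hF hG hfin).1 (ia.add (integrable_const
    (∫ θ₂, max (virtualReal F f θ₂) 0 ∂F))) fun θ₁ => ?_
  · refine (he.revenue_le_surplus hF hG hfin).trans (h.trans_eq ?_)
    rw [integral_add' ia (integrable_const _)]
    simp
  have h2 := integral_mono (e.integrable_surplus hF θ₁ (virtualReal G g θ₁))
    ((integrable_const (max (virtualReal G g θ₁) 0)).add ib) fun θ₂ => ?_
  · rw [integral_add' (integrable_const _) ib] at h2
    simpa using h2
  -- The two allocations are bounded separately, dropping the constraint that they sum to at most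
  -- one.
  have hle : ∀ a q : ℝ, q ∈ Icc (0 : ℝ) 1 → a * q ≤ max a 0 := fun a q hq =>
    (mul_le_mul_of_nonneg_right (le_max_left a 0) hq.1).trans
      (mul_le_of_le_one_right (le_max_right a 0) hq.2)
  exact add_le_add (hle _ _ (e.expAlloc₁_mem θ₁ θ₂)) (hle _ _ (e.expAlloc₂_mem θ₁ θ₂))

/-- An upper bound on revenue without buybacks. -/
lemma revenue_le_maxSurplus (hF : IsTypeLaw F f) (hG : IsTypeLaw G g)
    (he : e.IsEquilibrium F G C) (hfin : e.FiniteTransfers F G) (hnb : e.NoBuyback) :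
    e.revenue F G ≤ maxSurplus F G f g := by
  have := hF.isProb
  obtain ⟨γ, hγ⟩ := hnb
  refine (he.revenue_le_surplus hF hG hfin).trans ?_
  refine integral_mono_ae (he.revenue_eq hF hG hfin).1 (integrable_integral_max hF hG) ?_
  filter_upwards [hG.ae_mem_Icc] with θ₁ hθ₁
  set a := virtualReal G g θ₁
  have hsum : ∀ θ₂ ∈ Icc (0 : ℝ) 1, e.expAlloc₁ θ₁ θ₂ + e.expAlloc₂ θ₁ θ₂ = γ θ₁ :=
    fun θ₂ hθ₂ => (e.expAlloc_add θ₁ θ₂).trans (hγ θ₁ hθ₁ θ₂ hθ₂)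
  have hγ01 : γ θ₁ ∈ Icc (0 : ℝ) 1 := by
    rw [← hsum 0 (by simp)]
    exact e.expAlloc_add_mem θ₁ 0
  have hi := integrable_max_const hF a
  have h1 := integral_mono_ae (e.integrable_surplus hF θ₁ a) (hi.const_mul (γ θ₁)) ?_
  · refine h1.trans ?_
    -- Absence of buybacks enters here: `γ θ₁` leaves the integral over `θ₂`. The remaining integral
    -- dominates the mean of `ψ_F`, which is zero, so `γ θ₁ ≤ 1` suffices.
    rw [integral_const_mul]
    refine mul_le_of_le_one_left ?_ hγ01.2
    rw [← hF.integral_virtualReal]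
    exact integral_mono hF.integrable_virtualReal hi fun x => le_max_right _ _
  · filter_upwards [hF.ae_mem_Icc] with θ₂ hθ₂
    rw [← hsum θ₂ hθ₂, add_mul, mul_comm _ (max _ _), mul_comm _ (max _ _)]
    exact add_le_add
      (mul_le_mul_of_nonneg_right (le_max_left _ _) (e.expAlloc₁_mem θ₁ θ₂).1)
      (mul_le_mul_of_nonneg_right (le_max_right _ _) (e.expAlloc₂_mem θ₁ θ₂).1)

end Profile.IsEquilibrium

end Surplus

/-! ### Bayesian beliefs -/

/-- A regular conditional distribution whose values are all concentrated on a set of full measure. -/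
lemma exists_condKernel_ae_mem {M : Type*} [MeasurableSpace M] (ρ : Measure (M × ℝ))
    [IsProbabilityMeasure ρ] {s : Set ℝ} (hs : MeasurableSet s) (hne : s.Nonempty)
    (h : ∀ᵐ z ∂ρ, z.2 ∈ s) :
    ∃ κ : Kernel M ℝ, IsMarkovKernel κ ∧ ρ = ρ.fst ⊗ₘ κ ∧ ∀ m, ∀ᵐ x ∂(κ m), x ∈ s := by
  classical
  obtain ⟨c, hc⟩ := hne
  have hS : MeasurableSet {m | ρ.condKernel m sᶜ = 0} :=
    ρ.condKernel.measurable_coe hs.compl (measurableSet_singleton 0)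
  have hae : ∀ᵐ m ∂ρ.fst, ρ.condKernel m sᶜ = 0 := by
    have h1 : ∀ᵐ z ∂(ρ.fst ⊗ₘ ρ.condKernel), z.2 ∈ s := by
      rwa [ρ.disintegrate ρ.condKernel]
    exact Measure.ae_ae_of_ae_compProd h1
  -- On the null set of menus with a bad conditional law the belief becomes a point mass in `s`, so
  -- that off-path beliefs are admissible too.
  let κ := Kernel.piecewise hS ρ.condKernel (Kernel.const M (Measure.dirac c))
  refine ⟨κ, inferInstance, ?_, fun m => ?_⟩
  · conv_lhs => rw [← ρ.disintegrate ρ.condKernel]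
    refine Measure.compProd_congr ?_
    filter_upwards [hae] with m hm
    simp only [κ, Kernel.piecewise_apply]
    exact (if_pos hm).symm
  · simp only [κ, Kernel.piecewise_apply]
    split_ifs with hm
    · exact hm
    · rw [Kernel.const_apply, ae_dirac_eq]
      exact hc

/-! ### Discounts and the intermediary's choice of resale price -/

section Prices

variable {F G : Measure ℝ} {f g : ℝ → ℝ}

lemma lowestPrice_mem (hF : IsTypeLaw F f) : lowestPrice F G f g ∈ Icc (0 : ℝ) 1 :=
  hF.virtualInv_mem (IsTypeLaw.virtualValue_le_one zero_le_one)

/-- The type of the intermediary whose virtual value equals that of a consumer of type `x`. -/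
noncomputable def matchedType (F G : Measure ℝ) (f g : ℝ → ℝ) (x : ℝ) : ℝ :=
  virtualInv G g (virtualValue F f x)

lemma matchedType_mem (hG : IsTypeLaw G g) {x : ℝ} (hx : x ∈ Icc (0 : ℝ) 1) :
    matchedType F G f g x ∈ Icc (0 : ℝ) 1 :=
  hG.virtualInv_mem (IsTypeLaw.virtualValue_le_one hx.2)

lemma integrableOn_matchedType_mul (hF : IsTypeLaw F f) (hG : IsTypeLaw G g) :
    IntegrableOn (fun x => matchedType F G f g x * f x) (Icc 0 1) := by
  have h : MonotoneOn (matchedType F G f g) (Icc 0 1) := fun x hx y hy hxy =>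
    hG.virtualInv_mono (hF.virtualValue_strictMonoOn.monotoneOn hx hy hxy)
      (IsTypeLaw.virtualValue_le_one hy.2)
  simpa [mul_comm] using (hF.integrable_iff _).1 (hF.integrable_of_monotoneOn h)

lemma intervalIntegrable_matchedType_mul (hF : IsTypeLaw F f) (hG : IsTypeLaw G g) {x y : ℝ}
    (hx : x ∈ Icc (0 : ℝ) 1) (hy : y ∈ Icc (0 : ℝ) 1) :
    IntervalIntegrable (fun x => matchedType F G f g x * f x) volume x y :=
  ((integrableOn_matchedType_mul hF hG).mono_set (uIcc_subset_Icc hx hy)).intervalIntegrable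

lemma intervalIntegrable_const_mul_density (hF : IsTypeLaw F f) (c : ℝ) {x y : ℝ}
    (hx : x ∈ Icc (0 : ℝ) 1) (hy : y ∈ Icc (0 : ℝ) 1) :
    IntervalIntegrable (fun x => c * f x) volume x y :=
  ((hF.integrableOn_density.mono_set (uIcc_subset_Icc hx hy)).intervalIntegrable).const_mul c

lemma integral_const_mul_density (hF : IsTypeLaw F f) (c : ℝ) {x y : ℝ} (hx : 0 ≤ x) (hxy : x ≤ y)
    (hy : y ≤ 1) : ∫ s in x..y, c * f s = c * (cdf F y - cdf F x) := by
  rw [intervalIntegral.integral_const_mul, intervalIntegral.integral_of_le hxy,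
    hF.cdf_sub hx hxy hy]

lemma integral_matchedType_le (hF : IsTypeLaw F f) (hG : IsTypeLaw G g) {c x y : ℝ} (hx : 0 ≤ x)
    (hxy : x ≤ y) (hy : y ≤ 1) (h : ∀ s ∈ Ioo x y, matchedType F G f g s ≤ c) :
    ∫ s in x..y, matchedType F G f g s * f s ≤ c * (cdf F y - cdf F x) := by
  rw [← integral_const_mul_density hF c hx hxy hy]
  refine intervalIntegral.integral_mono_on_of_le_Ioo hxy
    (intervalIntegrable_matchedType_mul hF hG ⟨hx, hxy.trans hy⟩ ⟨hx.trans hxy, hy⟩)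
    (intervalIntegrable_const_mul_density hF c ⟨hx, hxy.trans hy⟩ ⟨hx.trans hxy, hy⟩)
    fun s hs => mul_le_mul_of_nonneg_right (h s hs)
      (hF.density_nonneg s ⟨hx.trans hs.1.le, hs.2.le.trans hy⟩)

lemma le_integral_matchedType (hF : IsTypeLaw F f) (hG : IsTypeLaw G g) {c x y : ℝ} (hx : 0 ≤ x)
    (hxy : x ≤ y) (hy : y ≤ 1) (h : ∀ s ∈ Ioo x y, c ≤ matchedType F G f g s) :
    c * (cdf F y - cdf F x) ≤ ∫ s in x..y, matchedType F G f g s * f s := by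
  rw [← integral_const_mul_density hF c hx hxy hy]
  refine intervalIntegral.integral_mono_on_of_le_Ioo hxy
    (intervalIntegrable_const_mul_density hF c ⟨hx, hxy.trans hy⟩ ⟨hx.trans hxy, hy⟩)
    (intervalIntegrable_matchedType_mul hF hG ⟨hx, hxy.trans hy⟩ ⟨hx.trans hxy, hy⟩)
    fun s hs => mul_le_mul_of_nonneg_right (h s hs)
      (hF.density_nonneg s ⟨hx.trans hs.1.le, hs.2.le.trans hy⟩)

/-- The matched type of `s ≤ p` lies between `0` and `s ≤ p`, so the subtracted integral lies
between `0` and `p F(p)`. -/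
lemma discount_mem (hF : IsTypeLaw F f) (hG : IsTypeLaw G g) (hFG : GainsFromTrade F G) {p : ℝ}
    (hp : p ∈ Icc (lowestPrice F G f g) 1) : discount F G f g p ∈ Icc 0 p := by
  have h0 := (lowestPrice_mem (G := G) (g := g) hF).1
  have hp0 := h0.trans hp.1
  have h1 := integral_matchedType_le hF hG (c := p) h0 hp.1 hp.2 fun s hs =>
    (hFG.virtualInv_le hF hG ⟨h0.trans hs.1.le, hs.2.le.trans hp.2⟩).trans hs.2.le
  have h2 := le_integral_matchedType hF hG (c := 0) h0 hp.1 hp.2 fun s hs =>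
    (matchedType_mem hG ⟨h0.trans hs.1.le, hs.2.le.trans hp.2⟩).1
  have h3 := mul_nonneg hp0 (cdf_nonneg F (lowestPrice F G f g))
  have h4 := mul_le_of_le_one_right hp0 (cdf_le_one F p)
  have e : discount F G f g p = p * cdf F p -
    ∫ s in (lowestPrice F G f g)..p, matchedType F G f g s * f s := rfl
  rw [mul_sub] at h1
  constructor <;> linarith

lemma measurable_discount (hF : IsTypeLaw F f) (hG : IsTypeLaw G g) :
    Measurable fun p : Icc (lowestPrice F G f g) 1 => discount F G f g p := by
  have h0 := lowestPrice_mem (G := G) (g := g) hF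
  have hmem : ∀ p : Icc (lowestPrice F G f g) 1, (p : ℝ) ∈ Icc (0 : ℝ) 1 :=
    fun p => ⟨h0.1.trans p.2.1, p.2.2⟩
  -- The integrand is nonnegative, so the integral is monotone in its upper limit and therefore
  -- measurable.
  have hmono : Monotone fun p : Icc (lowestPrice F G f g) 1 =>
      ∫ s in (lowestPrice F G f g)..p, matchedType F G f g s * f s := by
    intro p r hpr
    have hpr' : (p : ℝ) ≤ r := hpr
    have h1 := intervalIntegral.integral_add_adjacent_intervals
      (intervalIntegrable_matchedType_mul hF hG h0 (hmem p))
      (intervalIntegrable_matchedType_mul hF hG (hmem p) (hmem r))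
    have h2 := le_integral_matchedType hF hG (c := 0) (hmem p).1 hpr' (hmem r).2 fun s hs =>
      (matchedType_mem hG ⟨(hmem p).1.trans hs.1.le, hs.2.le.trans (hmem r).2⟩).1
    simp only
    linarith
  have hcdf : Measurable (cdf F : ℝ → ℝ) := (monotone_cdf F).measurable
  exact (measurable_subtype_coe.mul (hcdf.comp measurable_subtype_coe)).sub hmono.measurable

/-- The resale price chosen by each type of the intermediary. -/
noncomputable def resalePrice (F G : Measure ℝ) (f g : ℝ → ℝ) (θ : ℝ) : ℝ :=
  virtualInv F f (virtualValue G g (projIcc 0 1 zero_le_one θ))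

lemma resalePrice_of_mem {θ : ℝ} (hθ : θ ∈ Icc (0 : ℝ) 1) :
    resalePrice F G f g θ = virtualInv F f (virtualValue G g θ) := by
  rw [resalePrice, projIcc_of_mem _ hθ]

/-- Clamping types to `[0,1]` makes the strategy monotone on the whole line; this gives the
measurability a kernel needs. -/
lemma resalePrice_mono (hF : IsTypeLaw F f) (hG : IsTypeLaw G g) :
    Monotone (resalePrice F G f g) := fun _ y hxy =>
  hF.virtualInv_mono (hG.virtualValue_strictMonoOn.monotoneOn (projIcc 0 1 _ _).2
    (projIcc 0 1 _ _).2 (monotone_projIcc _ hxy))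
    (IsTypeLaw.virtualValue_le_one (projIcc 0 1 zero_le_one y).2.2)

lemma resalePrice_mem (hF : IsTypeLaw F f) (hG : IsTypeLaw G g) (θ : ℝ) :
    resalePrice F G f g θ ∈ Icc (lowestPrice F G f g) 1 := by
  have h1 : (projIcc (0 : ℝ) 1 zero_le_one θ : ℝ) ∈ Icc (0 : ℝ) 1 := (projIcc 0 1 zero_le_one θ).2
  exact ⟨hF.virtualInv_mono (hG.virtualValue_strictMonoOn.monotoneOn (by simp) h1 h1.1)
    (IsTypeLaw.virtualValue_le_one h1.2), (hF.virtualInv_mem (IsTypeLaw.virtualValue_le_one h1.2)).2⟩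

/-- The intermediary's payoff from offering the price agreement with resale price `p`. -/
noncomputable def pricePayoff (F G : Measure ℝ) (f g : ℝ → ℝ) (θ p : ℝ) : ℝ :=
  θ * cdf F p - ∫ s in (lowestPrice F G f g)..p, matchedType F G f g s * f s

/-- Single crossing: two payoffs differ by the integral of `θ - matchedType` against `F` between the
prices, and this integrand is nonnegative below `resalePrice θ` and nonpositive above it. -/
lemma pricePayoff_le (hF : IsTypeLaw F f) (hG : IsTypeLaw G g) {θ p : ℝ}
    (hθ : θ ∈ Icc (0 : ℝ) 1) (hp : p ∈ Icc (lowestPrice F G f g) 1) :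
    pricePayoff F G f g θ p ≤ pricePayoff F G f g θ (resalePrice F G f g θ) := by
  have h0 := lowestPrice_mem (G := G) (g := g) hF
  have hr' := resalePrice_mem (f := f) (g := g) hF hG θ
  have hr : resalePrice F G f g θ ∈ Icc (0 : ℝ) 1 := ⟨h0.1.trans hr'.1, hr'.2⟩
  have hp' : p ∈ Icc (0 : ℝ) 1 := ⟨h0.1.trans hp.1, hp.2⟩
  have h1 := intervalIntegral.integral_interval_sub_left
      (intervalIntegrable_matchedType_mul hF hG h0 hr)
      (intervalIntegrable_matchedType_mul hF hG h0 hp')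
  rw [pricePayoff, pricePayoff]
  have hv : virtualValue G g θ ≤ 1 := IsTypeLaw.virtualValue_le_one hθ.2
  rcases le_total p (resalePrice F G f g θ) with hle | hle
  · have h2 := integral_matchedType_le hF hG (c := θ) hp'.1 hle hr.2 fun s hs => ?_
    · rw [mul_sub] at h2; linarith
    · have hs' : s ∈ Icc (0 : ℝ) 1 := ⟨hp'.1.trans hs.1.le, hs.2.le.trans hr.2⟩
      have h3 := hs.2
      rw [resalePrice_of_mem hθ] at h3
      exact IsTypeLaw.virtualInv_le hθ (IsTypeLaw.lt_of_lt_virtualInv hs' h3).le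
  · have h2 := le_integral_matchedType hF hG (c := θ) hr.1 hle hp'.2 fun s hs => ?_
    · rw [intervalIntegral.integral_symm, mul_sub] at h2
      rw [mul_comm] at h2
      linarith
    · have hs' : s ∈ Icc (0 : ℝ) 1 := ⟨hr.1.trans hs.1.le, hs.2.le.trans hp'.2⟩
      have h3 := hs.1
      rw [resalePrice_of_mem hθ] at h3
      have h4 := hF.le_of_virtualInv_lt hs' hv h3
      rw [← hG.virtualInv_virtualValue hθ]
      exact hG.virtualInv_mono h4 (IsTypeLaw.virtualValue_le_one hs'.2)

/-- The lowest price already guarantees `θ F(p̂) ≥ 0`. -/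
lemma pricePayoff_nonneg (hF : IsTypeLaw F f) (hG : IsTypeLaw G g) {θ : ℝ}
    (hθ : θ ∈ Icc (0 : ℝ) 1) : 0 ≤ pricePayoff F G f g θ (resalePrice F G f g θ) := by
  have h0 := lowestPrice_mem (G := G) (g := g) hF
  refine le_trans ?_ (pricePayoff_le hF hG hθ ⟨le_rfl, h0.2⟩)
  rw [pricePayoff, intervalIntegral.integral_same, sub_zero]
  exact mul_nonneg hθ.1 (cdf_nonneg F _)

end Prices

instance {α β : Type*} [MeasurableSpace α] [MeasurableSpace β] [MeasurableSingletonClass α]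
    [MeasurableSingletonClass β] : MeasurableSingletonClass (α ⊕ β) := by
  refine ⟨fun x => ?_⟩
  rcases x with a | b
  · rw [← image_singleton]; exact measurableSet_inl_image.2 (measurableSet_singleton a)
  · rw [← image_singleton]; exact measurableSet_inr_image.2 (measurableSet_singleton b)

/-! ### Strategies under price agreements -/

/-- The consumer buys the good under the price agreement `(p, w)`. -/
def buyOutcome (p w : ℝ) : Outcome := ⟨((0, 1), (w - p, p)), by norm_num⟩

/-- The intermediary keeps the good under the price agreement `(p, w)`. -/
def keepOutcome (w : ℝ) : Outcome := ⟨((1, 0), (w, 0)), by norm_num⟩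

section Response

variable (F G : Measure ℝ) (f g : ℝ → ℝ)

/-- The consumer's strategy: buy whenever the value is at least the resale price. -/
noncomputable def buyerResponse (z : (Icc (lowestPrice F G f g) 1 ⊕ Unit) × ℝ) : Outcome :=
  if Sum.elim (fun p : Icc (lowestPrice F G f g) 1 => (p : ℝ)) (fun _ => 0) z.1 ≤ z.2 then
    Sum.elim (fun p : Icc (lowestPrice F G f g) 1 => buyOutcome p (p - discount F G f g p))
      (fun _ => noTrade) z.1
  else Sum.elim (fun p : Icc (lowestPrice F G f g) 1 => keepOutcome (p - discount F G f g p))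
      (fun _ => noTrade) z.1

variable {F G f g}

lemma measurable_buyerResponse (hF : IsTypeLaw F f) (hG : IsTypeLaw G g) :
    Measurable (buyerResponse F G f g) := by
  have hd := measurable_discount hF hG
  have h1 : Measurable fun p : Icc (lowestPrice F G f g) 1 =>
      buyOutcome p (p - discount F G f g p) := by
    refine Measurable.subtype_mk ?_
    exact measurable_const.prodMk
      (((measurable_subtype_coe.sub hd).sub measurable_subtype_coe).prodMk measurable_subtype_coe)
  have h2 : Measurable fun p : Icc (lowestPrice F G f g) 1 =>
      keepOutcome (p - discount F G f g p) := by
    refine Measurable.subtype_mk ?_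
    exact measurable_const.prodMk ((measurable_subtype_coe.sub hd).prodMk measurable_const)
  refine Measurable.ite (measurableSet_le ?_ measurable_snd) ?_ ?_
  · exact (measurable_subtype_coe.sumElim measurable_const).comp measurable_fst
  · exact (h1.sumElim measurable_const).comp measurable_fst
  · exact (h2.sumElim measurable_const).comp measurable_fst

lemma buyerResponse_inl_of_le {p : Icc (lowestPrice F G f g) 1} {θ : ℝ} (h : (p : ℝ) ≤ θ) :
    buyerResponse F G f g (Sum.inl p, θ) = buyOutcome p (p - discount F G f g p) := by
  simp [buyerResponse, h]

lemma buyerResponse_inl_of_lt {p : Icc (lowestPrice F G f g) 1} {θ : ℝ} (h : θ < (p : ℝ)) :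
    buyerResponse F G f g (Sum.inl p, θ) = keepOutcome (p - discount F G f g p) := by
  simp [buyerResponse, not_le.2 h]

lemma buyerResponse_inr (θ : ℝ) : buyerResponse F G f g (Sum.inr (), θ) = noTrade :=
  ite_self _

lemma buyerResponse_mem (m : Icc (lowestPrice F G f g) 1 ⊕ Unit) (θ : ℝ) :
    buyerResponse F G f g (m, θ) ∈ fullMenu (agreements F G f g) m := by
  rcases m with p | _
  · rcases le_or_gt (p : ℝ) θ with h | h
    · rw [buyerResponse_inl_of_le h]
      exact Or.inl rfl
    · rw [buyerResponse_inl_of_lt h]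
      exact Or.inr rfl
  · exact buyerResponse_inr θ

lemma buyerResponse_optimal (m : Icc (lowestPrice F G f g) 1 ⊕ Unit) (θ : ℝ) (y : Outcome)
    (hy : y ∈ insert noTrade (fullMenu (agreements F G f g) m)) :
    u₂ y θ ≤ u₂ (buyerResponse F G f g (m, θ)) θ := by
  have h0 : u₂ noTrade θ = 0 := by simp [u₂, noTrade, q₂, t₂]
  rcases m with p | _
  · have h1 : ∀ w, u₂ (buyOutcome p w) θ = θ - p := by simp [u₂, buyOutcome, q₂, t₂]
    have h2 : ∀ w, u₂ (keepOutcome w) θ = 0 := by simp [u₂, keepOutcome, q₂, t₂]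
    have hy' : y = noTrade ∨ y = buyOutcome p (p - discount F G f g p) ∨
        y = keepOutcome (p - discount F G f g p) := hy
    rcases le_or_gt (p : ℝ) θ with h | h
    · rw [buyerResponse_inl_of_le h, h1]
      rcases hy' with rfl | rfl | rfl <;> simp only [h0, h1, h2] <;> linarith
    · rw [buyerResponse_inl_of_lt h, h2]
      rcases hy' with rfl | rfl | rfl <;> simp only [h0, h1, h2] <;> linarith
  · have hy' : y = noTrade := by simpa [fullMenu] using hy
    rw [buyerResponse_inr, hy']

/-- By `discount_mem` the discount and the discounted price both lie in `[0, p]`. -/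
lemma abs_t_buyerResponse_le (hF : IsTypeLaw F f) (hG : IsTypeLaw G g) (hFG : GainsFromTrade F G)
    (z : (Icc (lowestPrice F G f g) 1 ⊕ Unit) × ℝ) :
    |t₁ (buyerResponse F G f g z)| ≤ 1 ∧ |t₂ (buyerResponse F G f g z)| ≤ 1 := by
  obtain ⟨m, θ⟩ := z
  rcases m with p | _
  · have hd := discount_mem hF hG hFG p.2
    have hp := p.2.2
    rcases le_or_gt (p : ℝ) θ with h | h
    · rw [buyerResponse_inl_of_le h]
      simp only [t₁, t₂, buyOutcome, abs_le]
      refine ⟨⟨?_, ?_⟩, ?_, ?_⟩ <;> linarith [hd.1, hd.2]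
    · rw [buyerResponse_inl_of_lt h]
      simp only [t₁, t₂, keepOutcome, abs_le]
      refine ⟨⟨?_, ?_⟩, ?_, ?_⟩ <;> linarith [hd.1, hd.2]
  · rw [buyerResponse_inr]
    simp [noTrade, t₁, t₂]

/-- The intermediary's strategy. -/
noncomputable def priceChoice (hF : IsTypeLaw F f) (hG : IsTypeLaw G g) (θ : ℝ) :
    Icc (lowestPrice F G f g) 1 ⊕ Unit :=
  Sum.inl ⟨resalePrice F G f g θ, resalePrice_mem hF hG θ⟩

lemma measurable_priceChoice (hF : IsTypeLaw F f) (hG : IsTypeLaw G g) :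
    Measurable (priceChoice hF hG) :=
  measurable_inl.comp (resalePrice_mono hF hG).measurable.subtype_mk

/-- A profile in which both players follow the strategies above and beliefs obey Bayes' rule. -/
lemma exists_priceProfile (hF : IsTypeLaw F f) (hG : IsTypeLaw G g) :
    ∃ e : Profile (Icc (lowestPrice F G f g) 1),
      (∀ θ, e.choice θ = Measure.dirac (priceChoice hF hG θ)) ∧
      (∀ z, e.response z = Measure.dirac (buyerResponse F G f g z)) ∧
      (∀ m, ∀ᵐ θ₁ ∂(e.belief m), θ₁ ∈ Icc (0 : ℝ) 1) ∧
      (G ⊗ₘ e.choice).map Prod.swap = (G.bind e.choice) ⊗ₘ e.belief := by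
  have := hG.isProb
  let c : Kernel ℝ (Icc (lowestPrice F G f g) 1 ⊕ Unit) :=
    Kernel.deterministic _ (measurable_priceChoice hF hG)
  have : IsProbabilityMeasure ((G ⊗ₘ c).map Prod.swap) :=
    Measure.isProbabilityMeasure_map measurable_swap.aemeasurable
  have hfst : ((G ⊗ₘ c).map Prod.swap).fst = G.bind c := by
    rw [Measure.fst_map_swap, Measure.snd_compProd]
  have hmem : ∀ᵐ z ∂((G ⊗ₘ c).map Prod.swap), z.2 ∈ Icc (0 : ℝ) 1 := by
    rw [ae_map_iff measurable_swap.aemeasurable (measurable_snd measurableSet_Icc)]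
    have h1 : ∀ᵐ θ ∂(G ⊗ₘ c).fst, θ ∈ Icc (0 : ℝ) 1 := by
      rw [Measure.fst_compProd]; exact hG.ae_mem_Icc
    exact ae_of_ae_map measurable_fst.aemeasurable h1
  obtain ⟨κ, hκ, hρ, hκm⟩ := exists_condKernel_ae_mem _ measurableSet_Icc ⟨0, by simp⟩ hmem
  rw [hfst] at hρ
  exact ⟨⟨c, Kernel.deterministic _ (measurable_buyerResponse hF hG), κ, inferInstance,
    inferInstance, hκ⟩, fun θ => Kernel.deterministic_apply (measurable_priceChoice hF hG) _,
    fun z => Kernel.deterministic_apply (measurable_buyerResponse hF hG) _, hκm, hρ⟩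

end Response

/-! ### The price-agreement equilibrium and its revenue -/

namespace Profile

variable {F G : Measure ℝ} {f g : ℝ → ℝ} {e : Profile (Icc (lowestPrice F G f g) 1)}

lemma menuLaw_eq_map (hr : ∀ z, e.response z = Measure.dirac (buyerResponse F G f g z))
    (hF : IsTypeLaw F f) (hG : IsTypeLaw G g) (m : Icc (lowestPrice F G f g) 1 ⊕ Unit) :
    e.menuLaw F m = F.map fun θ₂ => buyerResponse F G f g (m, θ₂) := by
  simp only [menuLaw, hr]
  exact Measure.bind_dirac_eq_map _ ((measurable_buyerResponse hF hG).comp measurable_prodMk_left)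

lemma outcomeLaw_eq_map (hr : ∀ z, e.response z = Measure.dirac (buyerResponse F G f g z))
    (hF : IsTypeLaw F f) (hG : IsTypeLaw G g) :
    e.outcomeLaw F G = ((G.bind e.choice).prod F).map (buyerResponse F G f g) := by
  rw [outcomeLaw, ← Measure.bind_dirac_eq_map _ (measurable_buyerResponse hF hG)]
  exact congrArg _ (funext hr)

lemma outcome_eq_dirac (hr : ∀ z, e.response z = Measure.dirac (buyerResponse F G f g z))
    {hF : IsTypeLaw F f} {hG : IsTypeLaw G g}
    (hc : ∀ θ, e.choice θ = Measure.dirac (priceChoice hF hG θ)) (θ₁ θ₂ : ℝ) :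
    e.outcome θ₁ θ₂ = Measure.dirac (buyerResponse F G f g (priceChoice hF hG θ₁, θ₂)) := by
  rw [outcome, hc, Measure.dirac_bind (e.measurable_response_right θ₂), hr]

/-- The intermediary nets `θ - p + d(p)`, plus `p - θ` with the probability `1 - F(p)` of resale.
The summand `p F(p)` of the discount cancels all terms in `p` outside the integral. -/
lemma delegatePayoff_inl (hr : ∀ z, e.response z = Measure.dirac (buyerResponse F G f g z))
    (hF : IsTypeLaw F f) (hG : IsTypeLaw G g) (θ : ℝ) (p : Icc (lowestPrice F G f g) 1) :
    e.delegatePayoff F θ (Sum.inl p) = pricePayoff F G f g θ p := by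
  have := hF.isProb
  have := hF.nullSingletonClass
  have hm : Measurable fun x => u₁ x θ := (measurable_q₁.const_mul θ).sub measurable_t₁
  have hm' : Measurable fun θ₂ => buyerResponse F G f g (Sum.inl p, θ₂) :=
    (measurable_buyerResponse hF hG).comp measurable_prodMk_left
  rw [delegatePayoff, menuLaw_eq_map hr hF hG, integral_map hm'.aemeasurable
    hm.aestronglyMeasurable]
  have e1 : (fun θ₂ => u₁ (buyerResponse F G f g (Sum.inl p, θ₂)) θ) =
      fun θ₂ => (θ - (p - discount F G f g p)) + (Ici (p : ℝ)).indicator (fun _ => p - θ) θ₂ := by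
    ext θ₂
    rcases le_or_gt (p : ℝ) θ₂ with h | h
    · rw [buyerResponse_inl_of_le h]
      simp [u₁, buyOutcome, q₁, t₁, h]
    · rw [buyerResponse_inl_of_lt h]
      simp [u₁, keepOutcome, q₁, t₁, h]
  rw [e1, integral_add (integrable_const _) ((integrable_const _).indicator measurableSet_Ici),
    integral_indicator measurableSet_Ici, setIntegral_const, ← measureReal_congr Ioi_ae_eq_Ici,
    ← compl_Iic, probReal_compl_eq_one_sub measurableSet_Iic, ← cdf_eq_real, integral_const,
    probReal_univ, one_smul, smul_eq_mul, discount, pricePayoff]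
  simp only [matchedType]
  ring

lemma delegatePayoff_inr (hr : ∀ z, e.response z = Measure.dirac (buyerResponse F G f g z))
    (hF : IsTypeLaw F f) (θ : ℝ) : e.delegatePayoff F θ (Sum.inr ()) = 0 := by
  have := hF.isProb
  have h1 : e.menuLaw F (Sum.inr ()) = Measure.dirac noTrade := by
    simp only [menuLaw, hr, buyerResponse_inr]
    simp
  rw [delegatePayoff, h1, integral_dirac]
  simp [u₁, noTrade, q₁, t₁]

lemma isEquilibrium_price {hF : IsTypeLaw F f} {hG : IsTypeLaw G g} (hFG : GainsFromTrade F G)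
    (hc : ∀ θ, e.choice θ = Measure.dirac (priceChoice hF hG θ))
    (hr : ∀ z, e.response z = Measure.dirac (buyerResponse F G f g z))
    (hb : ∀ m, ∀ᵐ θ₁ ∂(e.belief m), θ₁ ∈ Icc (0 : ℝ) 1)
    (hbayes : (G ⊗ₘ e.choice).map Prod.swap = (G.bind e.choice) ⊗ₘ e.belief) :
    e.IsEquilibrium F G (agreements F G f g) := by
  have := hF.isProb
  constructor
  · intro m θ _
    rw [hr, ae_dirac_eq]
    exact mem_insert_of_mem _ (buyerResponse_mem m θ)
  · exact hb
  · intro m θ _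
    rw [hr]
    exact integrable_dirac (by simp)
  · intro m θ _ y hy
    simp only [agentPayoff, hr, integral_dirac]
    simpa using buyerResponse_optimal m θ y hy
  · intro m
    rw [menuLaw_eq_map hr hF hG]
    have hm : Measurable fun θ₂ => buyerResponse F G f g (m, θ₂) :=
      (measurable_buyerResponse hF hG).comp measurable_prodMk_left
    rw [integrable_map_measure measurable_t₁.aestronglyMeasurable hm.aemeasurable]
    exact Integrable.of_bound (measurable_t₁.comp hm).aestronglyMeasurable 1
      (.of_forall fun θ => (abs_t_buyerResponse_le hF hG hFG (m, θ)).1)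
  · intro θ _
    rw [hc]
    exact integrable_dirac (by simp)
  · intro θ hθ m
    rw [hc, integral_dirac, priceChoice, delegatePayoff_inl hr hF hG]
    rcases m with p | _
    · rw [delegatePayoff_inl hr hF hG]
      exact pricePayoff_le hF hG hθ p.2
    · rw [delegatePayoff_inr hr hF]
      exact pricePayoff_nonneg hF hG hθ
  · exact hbayes

lemma finiteTransfers_price (hF : IsTypeLaw F f) (hG : IsTypeLaw G g) (hFG : GainsFromTrade F G)
    (hr : ∀ z, e.response z = Measure.dirac (buyerResponse F G f g z)) :
    e.FiniteTransfers F G := by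
  have := hF.isProb
  have := hG.isProb
  have hm := measurable_buyerResponse hF hG
  rw [FiniteTransfers, outcomeLaw_eq_map hr hF hG,
    integrable_map_measure measurable_t₁.aestronglyMeasurable hm.aemeasurable,
    integrable_map_measure measurable_t₂.aestronglyMeasurable hm.aemeasurable]
  exact ⟨Integrable.of_bound (measurable_t₁.comp hm).aestronglyMeasurable 1
      (.of_forall fun z => (abs_t_buyerResponse_le hF hG hFG z).1),
    Integrable.of_bound (measurable_t₂.comp hm).aestronglyMeasurable 1
      (.of_forall fun z => (abs_t_buyerResponse_le hF hG hFG z).2)⟩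

lemma q_add_buyerResponse_inl (p : Icc (lowestPrice F G f g) 1) (θ : ℝ) :
    q₁ (buyerResponse F G f g (Sum.inl p, θ)) + q₂ (buyerResponse F G f g (Sum.inl p, θ)) = 1 := by
  rcases le_or_gt (p : ℝ) θ with h | h
  · rw [buyerResponse_inl_of_le h]
    simp [buyOutcome, q₁, q₂]
  · rw [buyerResponse_inl_of_lt h]
    simp [keepOutcome, q₁, q₂]

/-- Every inequality behind the bound by `maxSurplus` is tight: the lowest types pay zero and the
good goes to the larger virtual value almost surely. -/
lemma revenue_price {hF : IsTypeLaw F f} {hG : IsTypeLaw G g}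
    (hc : ∀ θ, e.choice θ = Measure.dirac (priceChoice hF hG θ))
    (hr : ∀ z, e.response z = Measure.dirac (buyerResponse F G f g z))
    (he : e.IsEquilibrium F G (agreements F G f g)) (hfin : e.FiniteTransfers F G) :
    e.revenue F G = maxSurplus F G f g := by
  have := hF.isProb
  have := hF.nullSingletonClass
  have h0 := lowestPrice_mem (G := G) (g := g) hF
  have hpay : ∀ m, e.pay₂ m 0 = 0 := by
    intro m
    rw [pay₂, hr, integral_dirac]
    rcases m with p | _
    · rcases le_or_gt (p : ℝ) 0 with h | h
      · rw [buyerResponse_inl_of_le h]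
        exact le_antisymm h (h0.1.trans p.2.1)
      · rw [buyerResponse_inl_of_lt h]
        simp [keepOutcome, t₂]
    · rw [buyerResponse_inr]
      simp [noTrade, t₂]
  -- Type `0` picks the lowest price, where the integral in his payoff runs over an empty interval.
  have hexp : e.expPay₁ F 0 = 0 := by
    have h00 : (0 : ℝ) ∈ Icc (0 : ℝ) 1 := by simp
    have h1 := he.delegatePayoff_eq (priceChoice hF hG 0) 0
    have h2 : resalePrice F G f g 0 = lowestPrice F G f g := resalePrice_of_mem h00
    rw [expPay₁, hc, integral_dirac]
    rw [priceChoice, delegatePayoff_inl hr hF hG] at h1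
    simp only [pricePayoff, h2, intervalIntegral.integral_same] at h1
    rw [priceChoice]
    simp only [h2]
    linarith
  rw [(he.revenue_eq hF hG hfin).2, hexp]
  simp only [hpay, integral_zero, add_zero]
  refine integral_congr_ae ?_
  filter_upwards [hG.ae_mem_Ioo] with θ₁ hθ₁
  refine integral_congr_ae ?_
  have hθ₁' := Ioo_subset_Icc_self hθ₁
  -- A consumer whose value equals the resale price is discarded: if `ψ_F` jumps there, his virtual
  -- value need not equal the intermediary's.
  filter_upwards [hF.ae_mem_Ioo, Measure.ae_ne F (resalePrice F G f g θ₁)] with θ₂ hθ₂ hne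
  have hθ₂' := Ioo_subset_Icc_self hθ₂
  rw [expAlloc₁, expAlloc₂, outcome_eq_dirac hr hc, integral_dirac, integral_dirac, priceChoice]
  rw [resalePrice_of_mem hθ₁'] at hne
  rcases lt_or_gt_of_ne hne with h | h
  · have h1 := IsTypeLaw.lt_of_lt_virtualInv hθ₂' h
    rw [hF.virtualValue_eq hθ₂, hG.virtualValue_eq hθ₁, EReal.coe_lt_coe_iff] at h1
    rw [← resalePrice_of_mem hθ₁'] at h
    rw [buyerResponse_inl_of_lt h, max_eq_left h1.le]
    simp [keepOutcome, q₁, q₂]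
  · have h1 := hF.le_of_virtualInv_lt hθ₂' (IsTypeLaw.virtualValue_le_one hθ₁'.2) h
    rw [hF.virtualValue_eq hθ₂, hG.virtualValue_eq hθ₁, EReal.coe_le_coe_iff] at h1
    rw [← resalePrice_of_mem hθ₁'] at h
    rw [buyerResponse_inl_of_le h.le, max_eq_right h1]
    simp [buyOutcome, q₁, q₂]

end Profile

end Resale

/-! ### Optimality and the factor two -/

theorem mainTheorem7 (F G : Measure ℝ) (f g : ℝ → ℝ)
    (hF : IsTypeLaw F f) (hG : IsTypeLaw G g) (hFG : GainsFromTrade F G) :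
    lowestPrice F G f g ∈ Icc (0 : ℝ) 1 ∧
    (∀ p ∈ Icc (lowestPrice F G f g) 1, discount F G f g p ∈ Icc 0 p) ∧
    ∃ e : Profile (Icc (lowestPrice F G f g) 1),
      e.IsEquilibrium F G (agreements F G f g) ∧ e.FiniteTransfers F G ∧ e.NoBuyback ∧
      -- every type of the intermediary buys, and the good never goes back to the seller
      (∀ θ₁ ∈ Icc (0 : ℝ) 1, e.choice θ₁ {Sum.inr ()} = 0) ∧
      (∀ θ₁ ∈ Icc (0 : ℝ) 1, ∀ θ₂ ∈ Icc (0 : ℝ) 1,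
        ∀ᵐ x ∂(e.outcome θ₁ θ₂), q₁ x + q₂ x = 1) ∧
      -- the revenue is maximal without buybacks, and compares to the optimum with buybacks
      IsGreatest (noBuybackRevenues F G) (e.revenue F G) ∧
      ∃ πBB : ℝ, IsLUB (delegationRevenues F G) πBB ∧
        1 / 2 * πBB ≤ e.revenue F G ∧ e.revenue F G ≤ πBB := by
  obtain ⟨e, hc, hr, hb, hbayes⟩ := exists_priceProfile hF hG
  have he := Profile.isEquilibrium_price hFG hc hr hb hbayes
  have hfin := Profile.finiteTransfers_price hF hG hFG hr
  have hq : ∀ θ₁ θ₂, ∀ᵐ x ∂(e.outcome θ₁ θ₂), q₁ x + q₂ x = 1 := by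
    intro θ₁ θ₂
    rw [Profile.outcome_eq_dirac hr hc, ae_dirac_eq]
    exact Profile.q_add_buyerResponse_inl _ _
  have hnb : e.NoBuyback := by
    refine ⟨fun _ => 1, fun θ₁ _ θ₂ _ => ?_⟩
    rw [integral_congr_ae (hq θ₁ θ₂)]
    simp
  have hrev := Profile.revenue_price hc hr he hfin
  have hmem : e.revenue F G ∈ delegationRevenues F G := ⟨_, _, _, e, he, hfin, rfl⟩
  have hub : ∀ R ∈ delegationRevenues F G, R ≤ 2 * e.revenue F G := by
    rintro R ⟨Λ, _, C, e', he', hfin', rfl⟩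
    rw [hrev]
    exact (he'.revenue_le_integral_max hF hG hfin').trans
      (integral_max_le_two_mul_maxSurplus hF hG hFG)
  refine ⟨lowestPrice_mem hF, fun p hp => discount_mem hF hG hFG hp, e, he, hfin, hnb,
    fun θ₁ _ => ?_, fun θ₁ _ θ₂ _ => hq θ₁ θ₂, ⟨⟨_, _, _, e, he, hfin, hnb, rfl⟩, ?_⟩,
    sSup (delegationRevenues F G), isLUB_csSup ⟨_, hmem⟩ ⟨_, hub⟩, ?_, le_csSup ⟨_, hub⟩ hmem⟩
  · rw [hc, Measure.dirac_apply]
    simp [priceChoice]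
  · rintro R ⟨Λ, _, C, e', he', hfin', hnb', rfl⟩
    rw [hrev]
    exact he'.revenue_le_maxSurplus hF hG hfin' hnb'
  · have := csSup_le ⟨_, hmem⟩ hub
    linarith
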